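/- Let $n\ge 1$. A \emph{standard hyper curve} in $\mathbb R^n\times\mathbb R^n$ is a union $\Gamma=\Gamma_1\cup\dots\cup\Gamma_r$ ($r\ge1$) of graphs $\Gamma_i=\{(x,\gamma_i(x)):x\in\mathcal D_i\}$, where each $\mathcal D_i\subset\mathbb R^n$ is a closed domain (the closure of a nonempty connected open set), each $\gamma_i:\mathcal D_i\to\mathbb R^n$ is injective and differentiable in the interior of $\mathcal D_i$ with nonvanishing Jacobian there, for $i\ne i'$ the equation $\gamma_i(x)=\gamma_{i'}(x)$ has at most finitely many solutions $x\in\mathcal D_i\cap\mathcal D_{i'}$, and for some $c>1$ all the maps $\gamma_i$ and $\gamma_i^{-1}:\gamma_i(\mathcal D_i)\to\mathcal D_i$ are Lipschitz with constant $c$. Write $\gamma^{-1}(E)=\bigcup_i\{x\in\mathcal D_i:\gamma_i(x)\in E\}$ and let $\rho(x,y)=\min_i \mathrm{dist}((x,y),\Gamma_i)$, with the Euclidean distance. An operator $T$ is of class $CZO_\gamma$, associated with the kernel $K:\Gamma^c\to\mathbb C$, if $T$ is a continuous linear operator from $C_c^\infty(\mathbb R^n)$ to $\mathcal D'(\mathbb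 R^n)$ that extends to a bounded operator on $L^2(\mathbb R^n)$, if for some $A,\delta>0$ and all $(x,y)\notin\Gamma$ \[ |K(x,y)|\le \frac{A}{\rho(x,y)^n},\qquad |K(x,y)-K(x,y')|\le\frac{A|y-y'|^\delta}{\rho(x,y)^{n+\delta}}\ \text{ when } |y-y'|\le\tfrac12\rho(x,y), \] \[ |K(x,y)-K(x',y)|\le\frac{A|x-x'|^\delta}{\rho(x,y)^{n+\delta}}\ \text{ when } |x-x'|\le\tfrac12\rho(x,y), \] and if for every $\varphi\in C_c^\infty(\mathbb R^n)$ one has $T\varphi(x)=\int_{\mathbb R^n}K(x,y)\varphi(y)\,dy$ for almost every $x\notin\gamma^{-1}(\operatorname{supp}\varphi)$ (so that the distribution kernel of $T$ coincides with $K$ on $\Gamma^c$). \textbf{Theorem.} Let $T$ be of class $CZO_\gamma$, associated with the kernel $K$, let $1\le p<\infty$ and $f\in L^p(\mathbb R^n)$. Then $Tf$ is well defined: there is a measurable function $Tf$, unique up to null sets, such that $Tf_k\to Tf$ in measure whenever $f_k\in L^2\cap L^p$ and $f_k\to f$ in $L^p$. Moreover, for almost every $x\notin\gamma^{-1}(\operatorname{supp}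 f)$, \[ Tf(x)=\int_{\mathbb R^n}K(x,y)f(y)\,dy , \] where the integral converges absolutely; here $\operatorname{supp} f$ is the complement of the largest open set on which $f=0$ almost everywhere. -/

import Mathlib

open MeasureTheory Filter Topology Set
open scoped ENNReal Distributions

/-- `Rn n` is `ℝⁿ` with the Euclidean norm and Lebesgue measure. -/
abbrev Rn (n : ℕ) : Type := EuclideanSpace ℝ (Fin n)

/-- A standard hyper curve in `ℝⁿ × ℝⁿ`: a union of `r ≥ 1` graphs
`Γᵢ = {(x, γᵢ x) : x ∈ Dᵢ}`. Only the values of `γᵢ` on `Dᵢ` matter. -/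
structure StandardHyperCurve (n : ℕ) where
  /-- the number of pieces -/
  r : ℕ
  r_pos : 0 < r
  /-- the domains `Dᵢ` -/
  D : Fin r → Set (Rn n)
  /-- the maps `γᵢ` -/
  γ : Fin r → Rn n → Rn n
  /-- each `Dᵢ` is a closed domain, i.e. the closure of a nonempty connected open set -/
  closed_domain : ∀ i, ∃ U : Set (Rn n), IsOpen U ∧ IsConnected U ∧ D i = closure U
  /-- each `γᵢ` is differentiable in the interior of `Dᵢ` ... -/
  differentiable : ∀ i, ∀ x ∈ interior (D i), DifferentiableAt ℝ (γ i) x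
  /-- ... and its Jacobian has no zero there -/
  jacobian_ne_zero : ∀ i, ∀ x ∈ interior (D i), (fderiv ℝ (γ i) x).det ≠ 0
  /-- two different pieces meet in at most finitely many points -/
  finite_meet : ∀ i j, i ≠ j → {x | x ∈ D i ∧ x ∈ D j ∧ γ i x = γ j x}.Finite
  /-- each `γᵢ` is injective on `Dᵢ`, and `γᵢ` and its inverse are Lipschitz -/
  lipschitz : ∃ c : ℝ, 1 < c ∧ ∀ i, ∀ x ∈ D i, ∀ x' ∈ D i,
    ‖γ i x - γ i x'‖ ≤ c * ‖x - x'‖ ∧ ‖x - x'‖ ≤ c * ‖γ i x - γ i x'‖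

namespace StandardHyperCurve

variable {n : ℕ} (Γ : StandardHyperCurve n)

/-- The piece `Γᵢ`, as a subset of `ℝⁿ × ℝⁿ` with the Euclidean distance of `ℝ²ⁿ`. -/
def piece (i : Fin Γ.r) : Set (WithLp 2 (Rn n × Rn n)) :=
  {q | ∃ x ∈ Γ.D i, q = WithLp.toLp 2 (x, Γ.γ i x)}

/-- `(x, y) ∈ Γ`. -/
def Mem (x y : Rn n) : Prop := ∃ i, x ∈ Γ.D i ∧ y = Γ.γ i x

/-- `ρ(x, y) = minᵢ dist((x, y), Γᵢ)`. -/
noncomputable def rho (x y : Rn n) : ℝ :=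
  ⨅ i : Fin Γ.r, Metric.infDist (WithLp.toLp 2 (x, y)) (Γ.piece i)

/-- `γ⁻¹(E) = ⋃ᵢ {x ∈ Dᵢ : γᵢ x ∈ E}`. -/
def preimage (E : Set (Rn n)) : Set (Rn n) := {x | ∃ i, x ∈ Γ.D i ∧ Γ.γ i x ∈ E}

/-- The size and regularity conditions, off `Γ`, on a kernel with singularities on `Γ`.
The values of `K` on `Γ` are irrelevant. -/
def IsKernel (K : Rn n → Rn n → ℂ) : Prop :=
  ∃ A δ : ℝ, 0 < A ∧ 0 < δ ∧ ∀ x y, ¬ Γ.Mem x y →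
    ‖K x y‖ ≤ A / Γ.rho x y ^ n ∧
    (∀ y', ‖y - y'‖ ≤ 1 / 2 * Γ.rho x y →
      ‖K x y - K x y'‖ ≤ A * ‖y - y'‖ ^ δ / Γ.rho x y ^ ((n : ℝ) + δ)) ∧
    (∀ x', ‖x - x'‖ ≤ 1 / 2 * Γ.rho x y →
      ‖K x y - K x' y‖ ≤ A * ‖x - x'‖ ^ δ / Γ.rho x y ^ ((n : ℝ) + δ))

end StandardHyperCurve

/-- A test function is square integrable. -/
theorem testFunction_memLp_two {n : ℕ} (φ : 𝓓((⊤ : TopologicalSpace.Opens (Rn n)), ℂ)) :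
    MemLp (φ : Rn n → ℂ) 2 volume :=
  φ.contDiff.continuous.memLp_of_hasCompactSupport φ.hasCompactSupport

/-- The class of a test function in `L²(ℝⁿ)`. -/
noncomputable def testToL2 {n : ℕ} (φ : 𝓓((⊤ : TopologicalSpace.Opens (Rn n)), ℂ)) :
    Lp ℂ 2 (volume : Measure (Rn n)) :=
  (testFunction_memLp_two φ).toLp φ

/-- An operator of class `CZO_γ` associated with the kernel `K`: a continuous linear operator
from `C_c^∞(ℝⁿ)` to `𝓓'(ℝⁿ)`, with its (unique) bounded extension to `L²(ℝⁿ)`, that is given by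
integration against `K` at almost every point off `γ⁻¹(supp φ)`. The last condition implies that
the distribution kernel of the operator coincides with `K` off `Γ`. -/
structure CZO {n : ℕ} (Γ : StandardHyperCurve n) (K : Rn n → Rn n → ℂ) where
  /-- the operator from test functions to distributions -/
  toDistribution : 𝓓((⊤ : TopologicalSpace.Opens (Rn n)), ℂ) →L[ℂ]
    𝓓'((⊤ : TopologicalSpace.Opens (Rn n)), ℂ)
  /-- its bounded extension to `L²` -/
  onL2 : Lp ℂ 2 (volume : Measure (Rn n)) →L[ℂ] Lp ℂ 2 (volume : Measure (Rn n))
  extends_test : ∀ (φ : 𝓓((⊤ : TopologicalSpace.Opens (Rn n)), ℂ))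
    (ψ : 𝓓((⊤ : TopologicalSpace.Opens (Rn n)), ℝ)),
    toDistribution φ ψ = ∫ x, (ψ x : ℂ) * onL2 (testToL2 φ) x
  isKernel : Γ.IsKernel K
  repr_test : ∀ φ : 𝓓((⊤ : TopologicalSpace.Opens (Rn n)), ℂ),
    ∀ᵐ x, x ∉ Γ.preimage (tsupport φ) → onL2 (testToL2 φ) x = ∫ y, K x y * φ y

/-- `g` is (a representative of) `T f`, for `f ∈ L^p(ℝⁿ)`, where `T` is extended from `L² ∩ L^p`
to `L^p`: for all `u k ∈ L² ∩ L^p` that converge to `f` in `L^p`, the functions `T (u k)` converge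
to `g` in measure. As `L² ∩ L^p` is dense in `L^p` for `1 ≤ p < ∞`, at most one `g` has this
property up to null sets. -/
def CZO.IsValue {n : ℕ} {Γ : StandardHyperCurve n} {K : Rn n → Rn n → ℂ} (T : CZO Γ K)
    (p : ℝ≥0∞) (f g : Rn n → ℂ) : Prop :=
  ∀ u : ℕ → Lp ℂ 2 (volume : Measure (Rn n)),
    (∀ k, MemLp (u k : Rn n → ℂ) p volume) →
    Tendsto (fun k => eLpNorm ((u k : Rn n → ℂ) - f) p volume) atTop (𝓝 0) →
    TendstoInMeasure volume (fun k => (T.onL2 (u k) : Rn n → ℂ)) atTop g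

/-- The support of (the class of) a measurable function: the complement of the largest open set
on which the function vanishes almost everywhere. -/
def essSupport {n : ℕ} (f : Rn n → ℂ) : Set (Rn n) :=
  (volume.restrict (Function.support f)).support

/-! Calderón–Zygmund theory uses the distance to the diagonal only through two facts: it is
1-Lipschitz in each variable, and its sections `{ρ(·, y) ≤ t}` and `{ρ(x, ·) ≤ t}` have measure `O(t
^ n)`. Both survive when the diagonal is replaced by `Γ`: the `γᵢ` are bi-Lipschitz, so a section of
the `t`-neighbourhood of `Γᵢ` has diameter `O(t)`. The structure `SingularKernel` records these
facts with the kernel estimates, symmetrically in `x` and `y`, so that it passes to the adjoint.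

The core is a weak type `(p, p)` inequality on `L² ∩ L^p` for every finite `p ≥ 1`. If `p ≤ 2`,
decompose `u` by the Calderón–Zygmund cubes of `|u|^p`. The good part is controlled by the `L²`
bound. A piece `b` of mean zero on a cube with centre `c` and size `s` has `T b` integrable on
`{ρ(·, c) ≥ 2s}`, and the complement of that set has measure comparable to the cube
(`Represents.volume_one_lt_enorm_sum_le`). If `p > 2`, the adjoint is of weak type `(1, 1)`;
interpolation with `L²` bounds it in `L^q`, `q` conjugate to `p`, on functions dominated by an
indicator. Testing against the phase of `T u` on `{|T u| > 1}` and absorbing with Young's inequality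
gives the claim (`HasWeakType.of_adjoint`).

By the weak type inequality, `T` sends sequences that converge in `L^p` to sequences that are Cauchy
in measure, which defines `T f` (`HasWeakType.exists_limit`). For the integral formula, `x ∉
γ⁻¹(supp f)` forces `ρ(x, ·)` to be bounded below on `supp f`. There `K(x, ·)` lies in every `L^q`
with `q > 1`, so Hölder's inequality gives absolute convergence. The formula passes from test
functions to `L²` by approximation (`CZO.represents`), and from `L²` to `L^p` by truncation and
dominated convergence. -/

/-! ### Kernels singular on the zero set of an abstract distance function -/

/-- Layer-cake bound for a bounded function in weak `L^d`. -/
theorem lintegral_rpow_le_of_meas_lt_le {α : Type*} [MeasurableSpace α] {μ : Measure α}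
    {f : α → ℝ} (hf : AEMeasurable f μ) (hf0 : ∀ x, 0 ≤ f x) {L d β : ℝ} (hL : 0 < L)
    (hd : 0 ≤ d) (hβ : d < β) (hfL : ∀ x, f x ≤ L) {C : ℝ≥0∞}
    (h : ∀ t, 0 < t → μ {x | t < f x} ≤ C * ENNReal.ofReal (t ^ (-d))) :
    ∫⁻ x, ENNReal.ofReal (f x ^ β) ∂μ ≤ C * ENNReal.ofReal (β / (β - d) * L ^ (β - d)) := by
  have hβ0 : 0 < β := hd.trans_lt hβ
  rw [lintegral_rpow_eq_lintegral_meas_lt_mul μ (ae_of_all _ hf0) hf hβ0]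
  have key : ∫⁻ t in Ioc 0 L, ENNReal.ofReal (t ^ (β - d - 1)) =
      ENNReal.ofReal (L ^ (β - d) / (β - d)) := by
    rw [← ofReal_integral_eq_lintegral_ofReal]
    · rw [← intervalIntegral.integral_of_le hL.le, integral_rpow (Or.inl (by linarith))]
      congr 1
      rw [sub_add_cancel, Real.zero_rpow (by linarith), sub_zero]
    · exact (intervalIntegrable_iff_integrableOn_Ioc_of_le hL.le).1
        (intervalIntegral.intervalIntegrable_rpow' (by linarith))
    · filter_upwards [ae_restrict_mem measurableSet_Ioc] with t ht
      exact Real.rpow_nonneg ht.1.le _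
  -- The distribution function vanishes beyond `L`, so only `(0, L]` contributes, and there `t ^ (β
  -- - d - 1)` is integrable because `β > d`.
  have : ∫⁻ t in Ioi 0, μ {a : α | t < f a} * ENNReal.ofReal (t ^ (β - 1)) ≤
      C * ∫⁻ t in Ioc 0 L, ENNReal.ofReal (t ^ (β - d - 1)) := by
    rw [← lintegral_const_mul _ (by fun_prop), ← lintegral_indicator measurableSet_Ioi,
      ← lintegral_indicator measurableSet_Ioc]
    refine lintegral_mono fun t => ?_
    by_cases h0 : 0 < t
    · rw [indicator_of_mem (show t ∈ Ioi 0 from h0)]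
      by_cases h1 : t ≤ L
      · rw [indicator_of_mem (show t ∈ Ioc 0 L from ⟨h0, h1⟩)]
        calc _ ≤ C * ENNReal.ofReal (t ^ (-d)) * ENNReal.ofReal (t ^ (β - 1)) := by
              gcongr; exact h t h0
          _ = _ := by
              rw [mul_assoc, ← ENNReal.ofReal_mul (by positivity), ← Real.rpow_add h0]
              ring_nf
      · have : {a : α | t < f a} = ∅ := by
          ext a; simpa using (hfL a).trans (not_le.1 h1).le
        simp [this]
    · rw [indicator_of_notMem (by simpa using h0)]; exact zero_le
  calc _ ≤ ENNReal.ofReal β * (C * ENNReal.ofReal (L ^ (β - d) / (β - d))) := by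
        rw [← key]; gcongr
    _ = _ := by
        rw [mul_left_comm, ← ENNReal.ofReal_mul hβ0.le]
        ring_nf

/-- A kernel on `ℝⁿ × ℝⁿ` that is singular where the 1-Lipschitz function `ρ` vanishes, the
sections of the sublevel sets of `ρ` being as small as for the distance to the diagonal. -/
structure SingularKernel {n : ℕ} (ρ : Rn n → Rn n → ℝ) (K : Rn n → Rn n → ℂ) (V A δ : ℝ) :
    Prop where
  V_nonneg : 0 ≤ V
  A_nonneg : 0 ≤ A
  δ_pos : 0 < δ
  nonneg : ∀ x y, 0 ≤ ρ x y
  lipschitz : ∀ x x' y y', ρ x y ≤ ρ x' y' + ‖x - x'‖ + ‖y - y'‖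
  volume_left : ∀ y t, 0 ≤ t → volume {x | ρ x y ≤ t} ≤ ENNReal.ofReal (V * t ^ n)
  volume_right : ∀ x t, 0 ≤ t → volume {y | ρ x y ≤ t} ≤ ENNReal.ofReal (V * t ^ n)
  size : ∀ x y, 0 < ρ x y → ‖K x y‖ ≤ A / ρ x y ^ n
  reg_right : ∀ x y y', 0 < ρ x y → ‖y - y'‖ ≤ 1 / 2 * ρ x y →
    ‖K x y - K x y'‖ ≤ A * ‖y - y'‖ ^ δ / ρ x y ^ ((n : ℝ) + δ)
  reg_left : ∀ x x' y, 0 < ρ x y → ‖x - x'‖ ≤ 1 / 2 * ρ x y →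
    ‖K x y - K x' y‖ ≤ A * ‖x - x'‖ ^ δ / ρ x y ^ ((n : ℝ) + δ)

namespace SingularKernel

variable {n : ℕ} {ρ : Rn n → Rn n → ℝ} {K : Rn n → Rn n → ℂ} {V A δ : ℝ}

/-- The kernel of the adjoint operator. -/
theorem adjoint (h : SingularKernel ρ K V A δ) :
    SingularKernel (fun x y => ρ y x) (fun x y => star (K y x)) V A δ where
  V_nonneg := h.V_nonneg
  A_nonneg := h.A_nonneg
  δ_pos := h.δ_pos
  nonneg x y := h.nonneg y x
  lipschitz x x' y y' := by linarith [h.lipschitz y y' x x']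
  volume_left := h.volume_right
  volume_right := h.volume_left
  size x y hxy := by rw [norm_star]; exact h.size y x hxy
  reg_right x y y' hxy hy := by
    rw [← star_sub, norm_star]; exact h.reg_left y y' x hxy hy
  reg_left x x' y hxy hx := by
    rw [← star_sub, norm_star]; exact h.reg_right y x x' hxy hx

theorem continuous_dist (h : SingularKernel ρ K V A δ) :
    Continuous fun q : Rn n × Rn n => ρ q.1 q.2 := by
  rw [continuous_iff_continuousAt]
  intro q
  rw [ContinuousAt, tendsto_iff_norm_sub_tendsto_zero]
  refine squeeze_zero (fun _ => norm_nonneg _)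
    (g := fun q' : Rn n × Rn n => ‖q'.1 - q.1‖ + ‖q'.2 - q.2‖) (fun q' => ?_) ?_
  · rw [Real.norm_eq_abs, abs_le]
    have h1 := h.lipschitz q.1 q'.1 q.2 q'.2
    have h2 := h.lipschitz q'.1 q.1 q'.2 q.2
    rw [norm_sub_rev q.1, norm_sub_rev q.2] at h1
    constructor <;> linarith
  · have : Continuous fun q' : Rn n × Rn n => ‖q'.1 - q.1‖ + ‖q'.2 - q.2‖ := by fun_prop
    simpa using this.tendsto q

theorem continuous_dist_left (h : SingularKernel ρ K V A δ) (y : Rn n) :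
    Continuous fun x => ρ x y :=
  h.continuous_dist.comp (by fun_prop : Continuous fun x : Rn n => (x, y))

theorem continuous_dist_right (h : SingularKernel ρ K V A δ) (x : Rn n) :
    Continuous fun y => ρ x y :=
  h.continuous_dist.comp (by fun_prop : Continuous fun y : Rn n => (x, y))

/-- Measurability of `K` is not a hypothesis: it comes from the regularity estimates, which make `K`
jointly continuous where `ρ > 0`. One moves first in `x`, then in `y`. -/
theorem continuousOn (h : SingularKernel ρ K V A δ) :
    ContinuousOn (fun q : Rn n × Rn n => K q.1 q.2) {q | 0 < ρ q.1 q.2} := by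
  intro q hq
  obtain ⟨x, y⟩ := q
  apply ContinuousAt.continuousWithinAt
  have hr : 0 < ρ x y := hq
  set r := ρ x y with hrdef
  rw [ContinuousAt, tendsto_iff_norm_sub_tendsto_zero]
  refine squeeze_zero' (Eventually.of_forall fun _ => norm_nonneg _)
    (g := fun q' : Rn n × Rn n => A * ‖x - q'.1‖ ^ δ / r ^ ((n : ℝ) + δ) +
      A * ‖y - q'.2‖ ^ δ / (r / 2) ^ ((n : ℝ) + δ)) ?_ ?_
  · have c1 : Continuous fun q' : Rn n × Rn n => ‖x - q'.1‖ := by fun_prop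
    have c2 : Continuous fun q' : Rn n × Rn n => ‖y - q'.2‖ := by fun_prop
    have e1 : ∀ᶠ q' : Rn n × Rn n in 𝓝 (x, y), ‖x - q'.1‖ < r / 4 :=
      c1.continuousAt.eventually_lt_const (by simpa using by linarith)
    have e2 : ∀ᶠ q' : Rn n × Rn n in 𝓝 (x, y), ‖y - q'.2‖ < r / 4 :=
      c2.continuousAt.eventually_lt_const (by simpa using by linarith)
    filter_upwards [e1, e2] with q' h1 h2
    -- Moving `x` by less than `r / 4` keeps `ρ` above `r / 2`, so a move of `y` by `r / 4` is still
    -- within the range of the second regularity estimate.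
    have h3 : r / 2 ≤ ρ q'.1 y := by
      have := h.lipschitz x q'.1 y y
      simp only [sub_self, norm_zero, add_zero] at this
      linarith
    have b1 := h.reg_left x q'.1 y hr (by linarith)
    have b2 := h.reg_right q'.1 y q'.2 (by linarith) (by linarith)
    have b3 : A * ‖y - q'.2‖ ^ δ / ρ q'.1 y ^ ((n : ℝ) + δ) ≤
        A * ‖y - q'.2‖ ^ δ / (r / 2) ^ ((n : ℝ) + δ) := by
      have := h.A_nonneg
      have := h.δ_pos
      gcongr
    calc ‖K q'.1 q'.2 - K x y‖ = ‖(K x y - K q'.1 y) + (K q'.1 y - K q'.1 q'.2)‖ := by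
          rw [← norm_neg]; congr 1; ring
      _ ≤ _ := (norm_add_le _ _).trans (by linarith)
  · have : Continuous fun q' : Rn n × Rn n => A * ‖x - q'.1‖ ^ δ / r ^ ((n : ℝ) + δ) +
      A * ‖y - q'.2‖ ^ δ / (r / 2) ^ ((n : ℝ) + δ) := by
      have hδ := h.δ_pos.le
      have c1 : Continuous fun q' : Rn n × Rn n => ‖x - q'.1‖ ^ δ :=
        (by fun_prop : Continuous fun q' : Rn n × Rn n => ‖x - q'.1‖).rpow_const fun _ => Or.inr hδ
      have c2 : Continuous fun q' : Rn n × Rn n => ‖y - q'.2‖ ^ δ :=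
        (by fun_prop : Continuous fun q' : Rn n × Rn n => ‖y - q'.2‖).rpow_const fun _ => Or.inr hδ
      fun_prop
    have h2 := this.tendsto (x, y)
    simpa [Real.zero_rpow h.δ_pos.ne'] using h2

/-- The restriction of the kernel to `{ρ > 0}` is measurable. -/
theorem measurable_indicator (h : SingularKernel ρ K V A δ) :
    Measurable ({q : Rn n × Rn n | 0 < ρ q.1 q.2}.indicator fun q => K q.1 q.2) := by
  have hm : MeasurableSet {q : Rn n × Rn n | 0 < ρ q.1 q.2} :=
    (isOpen_lt continuous_const h.continuous_dist).measurableSet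
  classical
  rw [← piecewise_eq_indicator]
  exact h.continuousOn.measurable_piecewise continuousOn_const hm

/-- The integrals of negative powers of `ρ` away from its zeros. -/
theorem lintegral_dist_rpow_left_le (h : SingularKernel ρ K V A δ) (y : Rn n) {s β : ℝ}
    (hs : 0 < s) (hβ : n < β) :
    ∫⁻ x in {x | s ≤ ρ x y}, ENNReal.ofReal (ρ x y ^ (-β)) ≤
      ENNReal.ofReal (V * (β / (β - n) * s ^ (n - β))) := by
  have hm : MeasurableSet {x | s ≤ ρ x y} :=
    (isClosed_le continuous_const (h.continuous_dist_left y)).measurableSet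
  have hf : Measurable ({x | s ≤ ρ x y}.indicator fun x => (ρ x y)⁻¹) :=
    (h.continuous_dist_left y).measurable.inv.indicator hm
  have hβ0 : 0 < β := (Nat.cast_nonneg n).trans_lt hβ
  -- The function `1 / ρ`, cut off to `{s ≤ ρ}`, is bounded by `1 / s` and lies in weak `L^n`, since
  -- `{1 / ρ > t}` is contained in `{ρ ≤ 1 / t}`, of measure at most `V * t ^ (-n)`.
  have key := lintegral_rpow_le_of_meas_lt_le (μ := volume) hf.aemeasurable (L := s⁻¹) (d := n)
    (β := β) (C := ENNReal.ofReal V)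
    (fun x => indicator_nonneg (fun x _ => inv_nonneg.2 (h.nonneg x y)) x) (inv_pos.2 hs)
    (Nat.cast_nonneg n) hβ
    (fun x => by
      by_cases hx : s ≤ ρ x y
      · rw [indicator_of_mem (show x ∈ {x | s ≤ ρ x y} from hx)]; gcongr
      · rw [indicator_of_notMem (show x ∉ {x | s ≤ ρ x y} from hx)]; positivity)
    (fun t ht => by
      refine (measure_mono (t := {x | ρ x y ≤ t⁻¹}) fun x hx => ?_).trans
        ((h.volume_left y t⁻¹ (inv_pos.2 ht).le).trans_eq ?_)
      · have hx : t < {x | s ≤ ρ x y}.indicator (fun x => (ρ x y)⁻¹) x := hx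
        by_cases hx' : s ≤ ρ x y
        · rw [indicator_of_mem (show x ∈ {x | s ≤ ρ x y} from hx')] at hx
          exact (le_inv_comm₀ (hs.trans_le hx') ht).2 hx.le
        · rw [indicator_of_notMem (show x ∉ {x | s ≤ ρ x y} from hx')] at hx
          exact absurd hx ht.not_gt
      · rw [← ENNReal.ofReal_mul h.V_nonneg, Real.rpow_neg ht.le, Real.rpow_natCast, inv_pow])
  rw [← ENNReal.ofReal_mul h.V_nonneg] at key
  rw [← lintegral_indicator hm]
  refine le_trans (lintegral_mono fun x => ?_) (key.trans_eq ?_)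
  · by_cases hx : s ≤ ρ x y
    · rw [indicator_of_mem (show x ∈ {x | s ≤ ρ x y} from hx),
        indicator_of_mem (show x ∈ {x | s ≤ ρ x y} from hx),
        Real.inv_rpow (h.nonneg x y), Real.rpow_neg (h.nonneg x y)]
    · rw [indicator_of_notMem (show x ∉ {x | s ≤ ρ x y} from hx)]; exact zero_le
  · rw [Real.inv_rpow hs.le, ← Real.rpow_neg hs.le, neg_sub]

theorem lintegral_dist_rpow_right_le (h : SingularKernel ρ K V A δ) (x : Rn n) {s β : ℝ}
    (hs : 0 < s) (hβ : n < β) :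
    ∫⁻ y in {y | s ≤ ρ x y}, ENNReal.ofReal (ρ x y ^ (-β)) ≤
      ENNReal.ofReal (V * (β / (β - n) * s ^ (n - β))) :=
  h.adjoint.lintegral_dist_rpow_left_le x hs hβ

end SingularKernel

/-! ### Geometry of the standard hyper curve -/

/-- Bound for the volume of a set of given diameter. -/
theorem volume_le_of_forall_norm_sub_le {n : ℕ} {S : Set (Rn n)} {R : ℝ} (hR : 0 ≤ R)
    (h : ∀ x ∈ S, ∀ x' ∈ S, ‖x - x'‖ ≤ R) :
    volume S ≤ ENNReal.ofReal (R ^ n * (volume (Metric.ball (0 : Rn n) 1)).toReal) := by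
  rcases S.eq_empty_or_nonempty with rfl | ⟨x₀, hx₀⟩
  · simp
  · have hS : S ⊆ Metric.closedBall x₀ R := fun x hx => by
      rw [Metric.mem_closedBall, dist_eq_norm]; exact h x hx x₀ hx₀
    refine (measure_mono hS).trans_eq ?_
    rw [Measure.addHaar_closedBall _ _ hR, ENNReal.ofReal_mul (by positivity),
      ENNReal.ofReal_toReal measure_ball_lt_top.ne, finrank_euclideanSpace_fin]

namespace StandardHyperCurve

variable {n : ℕ} (Γ : StandardHyperCurve n)

theorem domain_nonempty (i : Fin Γ.r) : (Γ.D i).Nonempty := by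
  obtain ⟨U, -, hU, h⟩ := Γ.closed_domain i
  exact h ▸ hU.nonempty.closure

theorem isClosed_domain (i : Fin Γ.r) : IsClosed (Γ.D i) := by
  obtain ⟨U, -, -, h⟩ := Γ.closed_domain i
  exact h ▸ isClosed_closure

theorem piece_nonempty (i : Fin Γ.r) : (Γ.piece i).Nonempty := by
  obtain ⟨x, hx⟩ := Γ.domain_nonempty i
  exact ⟨_, x, hx, rfl⟩

theorem nonempty_index : Nonempty (Fin Γ.r) := ⟨⟨0, Γ.r_pos⟩⟩

theorem rho_nonneg (x y : Rn n) : 0 ≤ Γ.rho x y := Real.iInf_nonneg fun _ => Metric.infDist_nonneg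

theorem rho_le_infDist (x y : Rn n) (i : Fin Γ.r) :
    Γ.rho x y ≤ Metric.infDist (WithLp.toLp 2 (x, y)) (Γ.piece i) :=
  ciInf_le (Set.finite_range _).bddBelow i

theorem exists_rho_eq (x y : Rn n) :
    ∃ i, Metric.infDist (WithLp.toLp 2 (x, y)) (Γ.piece i) = Γ.rho x y :=
  haveI := Γ.nonempty_index
  exists_eq_ciInf_of_finite

theorem rho_eq_zero {i : Fin Γ.r} {x : Rn n} (hx : x ∈ Γ.D i) : Γ.rho x (Γ.γ i x) = 0 :=
  le_antisymm ((Γ.rho_le_infDist x _ i).trans_eq (Metric.infDist_zero_of_mem ⟨x, hx, rfl⟩))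
    (Γ.rho_nonneg _ _)

theorem not_mem_of_rho_pos {x y : Rn n} (h : 0 < Γ.rho x y) : ¬ Γ.Mem x y := by
  rintro ⟨i, hx, rfl⟩
  exact h.ne' (Γ.rho_eq_zero hx)

theorem dist_toLp_eq (x x' y y' : Rn n) :
    dist (WithLp.toLp 2 (x, y)) (WithLp.toLp 2 (x', y')) = √(‖x - x'‖ ^ 2 + ‖y - y'‖ ^ 2) := by
  rw [WithLp.prod_dist_eq_of_L2]
  simp only [dist_eq_norm]
  rfl

theorem dist_toLp_le (x x' y y' : Rn n) :
    dist (WithLp.toLp 2 (x, y)) (WithLp.toLp 2 (x', y')) ≤ ‖x - x'‖ + ‖y - y'‖ := by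
  rw [dist_toLp_eq, Real.sqrt_le_iff]
  refine ⟨by positivity, ?_⟩
  nlinarith [mul_nonneg (norm_nonneg (x - x')) (norm_nonneg (y - y'))]

theorem norm_fst_le_dist_toLp (x x' y y' : Rn n) :
    ‖x - x'‖ ≤ dist (WithLp.toLp 2 (x, y)) (WithLp.toLp 2 (x', y')) := by
  rw [dist_toLp_eq]
  exact Real.le_sqrt_of_sq_le (by nlinarith [sq_nonneg ‖y - y'‖])

theorem norm_snd_le_dist_toLp (x x' y y' : Rn n) :
    ‖y - y'‖ ≤ dist (WithLp.toLp 2 (x, y)) (WithLp.toLp 2 (x', y')) := by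
  rw [dist_toLp_eq]
  exact Real.le_sqrt_of_sq_le (by nlinarith [sq_nonneg ‖x - x'‖])

theorem rho_lipschitz (x x' y y' : Rn n) :
    Γ.rho x y ≤ Γ.rho x' y' + ‖x - x'‖ + ‖y - y'‖ := by
  obtain ⟨i, hi⟩ := Γ.exists_rho_eq x' y'
  have h1 := Γ.rho_le_infDist x y i
  have h2 := Metric.infDist_le_infDist_add_dist (s := Γ.piece i)
    (x := WithLp.toLp 2 (x, y)) (y := WithLp.toLp 2 (x', y'))
  have h3 := dist_toLp_le x x' y y'
  linarith

theorem exists_near_of_infDist_lt {x y : Rn n} {i : Fin Γ.r} {t : ℝ}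
    (h : Metric.infDist (WithLp.toLp 2 (x, y)) (Γ.piece i) < t) :
    ∃ z ∈ Γ.D i, ‖x - z‖ < t ∧ ‖y - Γ.γ i z‖ < t := by
  obtain ⟨q, ⟨z, hz, rfl⟩, hq⟩ := (Metric.infDist_lt_iff (Γ.piece_nonempty i)).1 h
  exact ⟨z, hz, (norm_fst_le_dist_toLp _ _ _ _).trans_lt hq,
    (norm_snd_le_dist_toLp _ _ _ _).trans_lt hq⟩

/-- A union of `r` sets of diameter at most `R * t`. -/
theorem volume_le_of_forall_piece {S : Set (Rn n)} {P : Fin Γ.r → Rn n → Prop} {R t : ℝ}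
    (hR : 0 ≤ R) (ht : 0 ≤ t) (hS : ∀ x ∈ S, ∃ i, P i x)
    (h : ∀ i x x', P i x → P i x' → ‖x - x'‖ ≤ R * t) :
    volume S ≤ ENNReal.ofReal
      (Γ.r * (R ^ n * (volume (Metric.ball (0 : Rn n) 1)).toReal) * t ^ n) := by
  calc volume S ≤ volume (⋃ i, {x | P i x}) :=
        measure_mono fun x hx => mem_iUnion.2 (hS x hx)
    _ ≤ ∑ i, volume {x | P i x} := measure_iUnion_fintype_le _ _
    _ ≤ ∑ _i : Fin Γ.r, ENNReal.ofReal
          ((R * t) ^ n * (volume (Metric.ball (0 : Rn n) 1)).toReal) :=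
        Finset.sum_le_sum fun i _ =>
          volume_le_of_forall_norm_sub_le (by positivity) fun x hx x' hx' => h i x x' hx hx'
    _ = _ := by
        rw [Finset.sum_const, Finset.card_univ, Fintype.card_fin, ← ENNReal.ofReal_nsmul,
          nsmul_eq_mul, mul_pow]
        ring_nf

/-- The kernels with singularities on the curve are singular kernels for `Γ.rho`. -/
theorem IsKernel.exists_singularKernel {Γ : StandardHyperCurve n} {K : Rn n → Rn n → ℂ}
    (hK : Γ.IsKernel K) : ∃ V A δ : ℝ, SingularKernel Γ.rho K V A δ := by
  obtain ⟨A, δ, hA, hδ, h⟩ := hK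
  obtain ⟨c, hc, hlip⟩ := Γ.lipschitz
  -- If `(x, y)` and `(x', y)` lie within `s` of `(z, γᵢ z)` and `(z', γᵢ z')`, then `γᵢ z` and `γᵢ
  -- z'` are `2s`-close, hence `z` and `z'` are `2cs`-close and `‖x - x'‖ ≤ 2s + 2cs`. The other
  -- section is treated alike, with the Lipschitz bound for `γᵢ` instead of its inverse.
  have hR : 0 ≤ 2 * (1 + c) := by linarith
  refine ⟨Γ.r * ((2 * (1 + c)) ^ n * (volume (Metric.ball (0 : Rn n) 1)).toReal), A, δ,
    by positivity, hA.le, hδ, Γ.rho_nonneg, Γ.rho_lipschitz, fun y t ht => ?_, fun x t ht => ?_,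
    fun x y hxy => (h x y (Γ.not_mem_of_rho_pos hxy)).1,
    fun x y y' hxy => (h x y (Γ.not_mem_of_rho_pos hxy)).2.1 y',
    fun x x' y hxy => (h x y (Γ.not_mem_of_rho_pos hxy)).2.2 x'⟩
  · refine Γ.volume_le_of_forall_piece
      (P := fun i x => Metric.infDist (WithLp.toLp 2 (x, y)) (Γ.piece i) ≤ t) hR ht
      (fun x hx => ?_) fun i x x' hx hx' => ?_
    · obtain ⟨i, hi⟩ := Γ.exists_rho_eq x y
      exact ⟨i, hi.trans_le hx⟩
    -- Near points on the piece are available only at distances strictly larger than the infimum, so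
    -- the bound is proved for `s > t` and `s` then decreases to `t`.
    · have : ∀ s > t, ‖x - x'‖ ≤ 2 * (1 + c) * s := fun s hs => by
        obtain ⟨z, hz, hz1, hz2⟩ := Γ.exists_near_of_infDist_lt (hx.trans_lt hs)
        obtain ⟨z', hz', hz1', hz2'⟩ := Γ.exists_near_of_infDist_lt (hx'.trans_lt hs)
        have h1 := (hlip i z hz z' hz').2
        have h2 : ‖Γ.γ i z - Γ.γ i z'‖ ≤ 2 * s := by
          rw [norm_sub_rev] at hz2
          have := norm_sub_le_norm_sub_add_norm_sub (Γ.γ i z) y (Γ.γ i z')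
          linarith
        have h3 := norm_sub_le_norm_sub_add_norm_sub x z x'
        have h4 := norm_sub_le_norm_sub_add_norm_sub z z' x'
        rw [norm_sub_rev] at hz1'
        nlinarith
      have h0 : Tendsto (fun s => 2 * (1 + c) * s) (𝓝[>] t) (𝓝 (2 * (1 + c) * t)) :=
        ((continuous_const.mul continuous_id).tendsto t).mono_left nhdsWithin_le_nhds
      exact ge_of_tendsto h0 (eventually_mem_nhdsWithin.mono this)
  · refine Γ.volume_le_of_forall_piece
      (P := fun i y => Metric.infDist (WithLp.toLp 2 (x, y)) (Γ.piece i) ≤ t) hR ht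
      (fun y hy => ?_) fun i y y' hy hy' => ?_
    · obtain ⟨i, hi⟩ := Γ.exists_rho_eq x y
      exact ⟨i, hi.trans_le hy⟩
    · have : ∀ s > t, ‖y - y'‖ ≤ 2 * (1 + c) * s := fun s hs => by
        obtain ⟨z, hz, hz1, hz2⟩ := Γ.exists_near_of_infDist_lt (hy.trans_lt hs)
        obtain ⟨z', hz', hz1', hz2'⟩ := Γ.exists_near_of_infDist_lt (hy'.trans_lt hs)
        have h1 := (hlip i z hz z' hz').1
        have h2 : ‖z - z'‖ ≤ 2 * s := by
          rw [norm_sub_rev] at hz1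
          have := norm_sub_le_norm_sub_add_norm_sub z x z'
          linarith
        have h3 := norm_sub_le_norm_sub_add_norm_sub y (Γ.γ i z) y'
        have h4 := norm_sub_le_norm_sub_add_norm_sub (Γ.γ i z) (Γ.γ i z') y'
        rw [norm_sub_rev] at hz2'
        nlinarith
      have h0 : Tendsto (fun s => 2 * (1 + c) * s) (𝓝[>] t) (𝓝 (2 * (1 + c) * t)) :=
        ((continuous_const.mul continuous_id).tendsto t).mono_left nhdsWithin_le_nhds
      exact ge_of_tendsto h0 (eventually_mem_nhdsWithin.mono this)

/-- Off `γ⁻¹(S)` the distance from `(x, y)` to the curve is bounded below, uniformly in `y ∈ S`. -/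
theorem exists_pos_le_rho {S : Set (Rn n)} (hS : IsClosed S) {x : Rn n}
    (hx : x ∉ Γ.preimage S) : ∃ ε > 0, ∀ y ∈ S, ε ≤ Γ.rho x y := by
  obtain ⟨c, hc, hlip⟩ := Γ.lipschitz
  have main : ∀ i, ∃ ε > 0, ∀ y ∈ S,
      ε ≤ Metric.infDist (WithLp.toLp 2 (x, y)) (Γ.piece i) := fun i => by
    by_cases hxi : x ∈ Γ.D i
    · have hnot : Γ.γ i x ∉ S := fun h => hx ⟨i, hxi, h⟩
      obtain ⟨η, hη, hball⟩ := Metric.isOpen_iff.1 hS.isOpen_compl _ hnot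
      -- If `(x, y)` is within `η / (c + 1)` of `(z, γᵢ z)`, then `‖y - γᵢ x‖ ≤ ‖y - γᵢ z‖ + c * ‖z
      -- - x‖ < η`, so `y` is in the ball around `γᵢ x` that misses `S`.
      have hε : 0 < η / (c + 1) := by positivity
      refine ⟨η / (c + 1), hε, fun y hy => le_of_not_gt fun hlt => ?_⟩
      obtain ⟨z, hz, h1, h2⟩ := Γ.exists_near_of_infDist_lt hlt
      refine absurd hy (hball (a := y) ?_)
      rw [Metric.mem_ball, dist_eq_norm]
      have h3 := (hlip i z hz x hxi).1
      have h4 := norm_sub_le_norm_sub_add_norm_sub y (Γ.γ i z) (Γ.γ i x)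
      rw [norm_sub_rev] at h1
      have h5 : η = c * (η / (c + 1)) + η / (c + 1) := by field_simp
      nlinarith
    · obtain ⟨ε, hε, hball⟩ := Metric.isOpen_iff.1 (Γ.isClosed_domain i).isOpen_compl _ hxi
      refine ⟨ε, hε, fun y hy => le_of_not_gt fun hlt => ?_⟩
      obtain ⟨z, hz, h1, h2⟩ := Γ.exists_near_of_infDist_lt hlt
      refine absurd hz (hball (a := z) ?_)
      rwa [Metric.mem_ball, dist_eq_norm, norm_sub_rev]
  choose ε hε h using main
  have := Γ.nonempty_index
  refine ⟨⨅ i, ε i, ?_, fun y hy => ?_⟩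
  · obtain ⟨i, hi⟩ := exists_eq_ciInf_of_finite (f := ε)
    exact hi ▸ hε i
  · obtain ⟨i, hi⟩ := Γ.exists_rho_eq x y
    rw [← hi]
    exact (ciInf_le (Set.finite_range _).bddBelow i).trans (h i y hy)

end StandardHyperCurve

/-! ### Absolute convergence away from the singularities -/

namespace SingularKernel

variable {n : ℕ} {ρ : Rn n → Rn n → ℝ} {K : Rn n → Rn n → ℂ} {V A δ : ℝ}

theorem isClosed_le_dist_right (h : SingularKernel ρ K V A δ) (x : Rn n) (ε : ℝ) :
    IsClosed {y | ε ≤ ρ x y} :=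
  isClosed_le continuous_const (h.continuous_dist_right x)

theorem isClosed_le_dist_left (h : SingularKernel ρ K V A δ) (y : Rn n) (ε : ℝ) :
    IsClosed {x | ε ≤ ρ x y} :=
  isClosed_le continuous_const (h.continuous_dist_left y)

/-- Allows arbitrary sets in `Represents`: the separation persists for closures, which are
measurable and have well-behaved thickenings. -/
theorem le_dist_of_mem_closure (h : SingularKernel ρ K V A δ) {S S' : Set (Rn n)} {ε : ℝ}
    (hS : ∀ x ∈ S', ∀ y ∈ S, ε ≤ ρ x y) : ∀ x ∈ closure S', ∀ y ∈ closure S, ε ≤ ρ x y := by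
  intro x hx y hy
  exact closure_minimal (s := S') (t := {x | ε ≤ ρ x y})
    (fun x' hx' => closure_minimal (s := S) (t := {y | ε ≤ ρ x' y}) (fun y' hy' => hS x' hx' y' hy')
      (h.isClosed_le_dist_right x' ε) hy) (h.isClosed_le_dist_left y ε) hx

theorem aestronglyMeasurable_indicator_right (h : SingularKernel ρ K V A δ) (x : Rn n) {ε : ℝ}
    (hε : 0 < ε) : AEStronglyMeasurable ({y | ε ≤ ρ x y}.indicator (K x)) volume := by
  have h1 : Measurable fun y => ({q : Rn n × Rn n | 0 < ρ q.1 q.2}.indicator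
      fun q => K q.1 q.2) (x, y) := h.measurable_indicator.comp (by fun_prop)
  have h2 := (h1.indicator (h.isClosed_le_dist_right x ε).measurableSet)
  convert h2.aestronglyMeasurable using 1
  ext y
  by_cases hy : ε ≤ ρ x y
  · rw [indicator_of_mem (show y ∈ {y | ε ≤ ρ x y} from hy),
      indicator_of_mem (show y ∈ {y | ε ≤ ρ x y} from hy), indicator_of_mem]
    exact hε.trans_le hy
  · rw [indicator_of_notMem (show y ∉ {y | ε ≤ ρ x y} from hy),
      indicator_of_notMem (show y ∉ {y | ε ≤ ρ x y} from hy)]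

theorem lintegral_kernel_rpow_right_le (h : SingularKernel ρ K V A δ) (hn : 1 ≤ n) (x : Rn n)
    {ε q : ℝ} (hε : 0 < ε) (hq : 1 < q) :
    ∫⁻ y, ‖{y | ε ≤ ρ x y}.indicator (K x) y‖ₑ ^ q ≤
      ENNReal.ofReal (A ^ q) *
        ENNReal.ofReal (V * (n * q / (n * q - n) * ε ^ (n - n * q))) := by
  have hn' : (1 : ℝ) ≤ n := by exact_mod_cast hn
  have hm := (h.isClosed_le_dist_right x ε).measurableSet
  calc ∫⁻ y, ‖{y | ε ≤ ρ x y}.indicator (K x) y‖ₑ ^ q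
      ≤ ∫⁻ y in {y | ε ≤ ρ x y}, ENNReal.ofReal (A ^ q) * ENNReal.ofReal (ρ x y ^ (-(n * q))) := by
        rw [← lintegral_indicator hm]
        refine lintegral_mono fun y => ?_
        by_cases hy : ε ≤ ρ x y
        · rw [indicator_of_mem (show y ∈ {y | ε ≤ ρ x y} from hy),
            indicator_of_mem (show y ∈ {y | ε ≤ ρ x y} from hy)]
          have hr := hε.trans_le hy
          have hA := h.A_nonneg
          rw [← ENNReal.ofReal_mul (by positivity), ← ofReal_norm,
            ENNReal.ofReal_rpow_of_nonneg (norm_nonneg _) (by linarith)]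
          refine ENNReal.ofReal_le_ofReal ?_
          calc ‖K x y‖ ^ q ≤ (A / ρ x y ^ n) ^ q := by
                gcongr; exact h.size x y hr
            _ = _ := by
                rw [Real.div_rpow hA (by positivity), ← Real.rpow_natCast, ← Real.rpow_mul hr.le,
                  Real.rpow_neg hr.le]
                rfl
        · rw [indicator_of_notMem (show y ∉ {y | ε ≤ ρ x y} from hy), enorm_zero,
            ENNReal.zero_rpow_of_pos (by linarith)]
          exact zero_le
    _ = ENNReal.ofReal (A ^ q) *
          ∫⁻ y in {y | ε ≤ ρ x y}, ENNReal.ofReal (ρ x y ^ (-(n * q))) :=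
        lintegral_const_mul' _ _ ENNReal.ofReal_ne_top
    _ ≤ _ := by
        gcongr
        exact h.lintegral_dist_rpow_right_le x hε (by nlinarith)

theorem memLp_indicator_right (h : SingularKernel ρ K V A δ) (hn : 1 ≤ n) (x : Rn n)
    {ε : ℝ} (hε : 0 < ε) {q : ℝ≥0∞} (hq : 1 < q) :
    MemLp ({y | ε ≤ ρ x y}.indicator (K x)) q volume := by
  have hA := h.A_nonneg
  rcases eq_or_ne q ∞ with rfl | hq'
  · refine memLp_top_of_bound (h.aestronglyMeasurable_indicator_right x hε) (A / ε ^ n)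
      (ae_of_all _ fun y => ?_)
    by_cases hy : ε ≤ ρ x y
    · rw [indicator_of_mem (show y ∈ {y | ε ≤ ρ x y} from hy)]
      exact (h.size x y (hε.trans_le hy)).trans (by gcongr)
    · rw [indicator_of_notMem (show y ∉ {y | ε ≤ ρ x y} from hy), norm_zero]
      positivity
  · refine ⟨h.aestronglyMeasurable_indicator_right x hε, ?_⟩
    rw [eLpNorm_lt_top_iff_lintegral_rpow_enorm_lt_top (zero_lt_one.trans hq).ne' hq']
    refine (h.lintegral_kernel_rpow_right_le hn x hε ?_).trans_lt
      (ENNReal.mul_lt_top ENNReal.ofReal_lt_top ENNReal.ofReal_lt_top)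
    rw [← ENNReal.toReal_one]
    exact (ENNReal.toReal_lt_toReal ENNReal.one_ne_top hq').2 hq

/-- Away from the singularities one may replace the kernel by its truncation. -/
theorem kernel_mul_ae_eq {x : Rn n} {ε : ℝ} {S : Set (Rn n)} {f : Rn n → ℂ}
    (hf : ∀ᵐ y, y ∉ S → f y = 0) (hx : ∀ y ∈ S, ε ≤ ρ x y) :
    (fun y => {y | ε ≤ ρ x y}.indicator (K x) y * f y) =ᵐ[volume] fun y => K x y * f y := by
  filter_upwards [hf] with y hy
  by_cases hyS : y ∈ S
  · rw [indicator_of_mem (show y ∈ {y | ε ≤ ρ x y} from hx y hyS)]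
  · rw [hy hyS, mul_zero, mul_zero]

/-- Hölder's inequality: `p < ∞` makes the conjugate exponent `q` larger than 1, hence `n * q > n`,
which is what integrability of `ρ ^ (-n * q)` at large distances requires. -/
theorem integrable_kernel_mul (h : SingularKernel ρ K V A δ) (hn : 1 ≤ n) {x : Rn n} {ε : ℝ}
    (hε : 0 < ε) {p : ℝ≥0∞} (hp1 : 1 ≤ p) (hp : p ≠ ∞) {f : Rn n → ℂ} (hfp : MemLp f p volume)
    {S : Set (Rn n)} (hf : ∀ᵐ y, y ∉ S → f y = 0) (hx : ∀ y ∈ S, ε ≤ ρ x y) :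
    Integrable (fun y => K x y * f y) volume := by
  refine Integrable.congr ?_ (kernel_mul_ae_eq hf hx)
  have : p.HolderConjugate p.conjExponent := ENNReal.HolderConjugate.conjExponent hp1
  have hq : 1 < p.conjExponent := by
    rw [ENNReal.conjExponent]
    exact ENNReal.lt_add_right (by simp) (ENNReal.inv_ne_zero.2 (by finiteness))
  exact (h.memLp_indicator_right hn x hε hq).integrable_mul (q := p) hfp

end SingularKernel

/-! ### The kernel representation on `L²`, for the operator and its adjoint -/

/-- `T` is given by integration against `K` away from the zeros of `ρ`. -/
def Represents {n : ℕ} (T : Lp ℂ 2 (volume : Measure (Rn n)) →L[ℂ] Lp ℂ 2 (volume : Measure (Rn n)))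
    (ρ : Rn n → Rn n → ℝ) (K : Rn n → Rn n → ℂ) : Prop :=
  ∀ (f : Lp ℂ 2 (volume : Measure (Rn n))) (S S' : Set (Rn n)) (ε : ℝ), 0 < ε →
    (∀ᵐ y, y ∉ S → f y = 0) → (∀ x ∈ S', ∀ y ∈ S, ε ≤ ρ x y) →
    ∀ᵐ x, x ∈ S' → T f x = ∫ y, K x y * f y

/-- Square integrable functions are limits of test functions with almost the same support. -/
theorem exists_testFunction_tendsto {n : ℕ} (f : Lp ℂ 2 (volume : Measure (Rn n)))
    {S : Set (Rn n)} (hS : IsClosed S) (hf : ∀ᵐ y, y ∉ S → f y = 0) {η : ℝ} (hη : 0 < η) :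
    ∃ φ : ℕ → 𝓓((⊤ : TopologicalSpace.Opens (Rn n)), ℂ),
      (∀ j, tsupport (φ j) ⊆ Metric.cthickening η S) ∧
      Tendsto (fun j => testToL2 (φ j)) atTop (𝓝 f) := by
  obtain ⟨χ, hχ0, hχ1, hχ⟩ := exists_contMDiffMap_zero_one_of_isClosed
    (n := ⊤) (modelWithCornersSelf ℝ (Rn n))
    (s := (Metric.thickening η S)ᶜ) (t := S) Metric.isOpen_thickening.isClosed_compl hS
    (disjoint_left.2 fun x hx hxS => hx (Metric.self_subset_thickening hη S hxS))
  have hχs : ContDiff ℝ ((⊤ : ℕ∞) : WithTop ℕ∞) χ := contMDiff_iff_contDiff.1 χ.contMDiff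
  have happ : ∀ j : ℕ, ∃ φ : 𝓓((⊤ : TopologicalSpace.Opens (Rn n)), ℂ),
      tsupport φ ⊆ Metric.cthickening η S ∧
      eLpNorm (φ - f : Rn n → ℂ) 2 volume ≤ ENNReal.ofReal (1 / ((j : ℝ) + 1)) := fun j => by
    obtain ⟨g, hg1, hg2, hg3⟩ := (Lp.memLp f).exist_eLpNorm_sub_le (by simp) (by simp)
      (ε := 1 / ((j : ℝ) + 1)) (by positivity)
    let φ : 𝓓((⊤ : TopologicalSpace.Opens (Rn n)), ℂ) :=
      ⟨fun x => χ x • g x, hχs.smul hg2, hg1.smul_left (f := χ), by simp⟩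
    refine ⟨φ, ?_, ?_⟩
    · refine (closure_mono (fun x hx => ?_)).trans (Metric.closure_thickening_subset_cthickening η S)
      by_contra hx'
      exact hx (show χ x • g x = 0 by rw [hχ0 hx']; simp)
    -- Multiplying by the cutoff does not spoil the approximation: on `S` it equals 1, and off `S`
    -- the function `f` vanishes while `|χ g| ≤ |g|`.
    · refine le_trans (eLpNorm_mono_ae ?_) hg3
      filter_upwards [hf] with x hx
      change ‖χ x • g x - f x‖ ≤ ‖f x - g x‖
      rw [norm_sub_rev (f x)]
      by_cases hxS : x ∈ S
      · rw [hχ1 hxS]; simp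
      · rw [hx hxS, sub_zero, sub_zero, norm_smul, Real.norm_eq_abs, abs_of_nonneg (hχ x).1]
        exact mul_le_of_le_one_left (norm_nonneg _) (hχ x).2
  choose φ hφ1 hφ2 using happ
  refine ⟨φ, hφ1, ?_⟩
  rw [← Lp.toLp_coeFn f (Lp.memLp f)]
  refine (Lp.tendsto_Lp_iff_tendsto_eLpNorm'' _ (fun j => testFunction_memLp_two (φ j)) _ _).2 ?_
  refine tendsto_of_tendsto_of_tendsto_of_le_of_le tendsto_const_nhds ?_ (fun _ => zero_le) hφ2
  rw [← ENNReal.ofReal_zero]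
  exact ENNReal.tendsto_ofReal tendsto_one_div_add_atTop_nhds_zero_nat

/-- An `L²` limit passes to the integrals against a square integrable function. -/
theorem tendsto_integral_mul {n : ℕ} {k : Rn n → ℂ} (hk : MemLp k 2 volume)
    {u : ℕ → Lp ℂ 2 (volume : Measure (Rn n))} {f : Lp ℂ 2 (volume : Measure (Rn n))}
    (hu : Tendsto u atTop (𝓝 f)) :
    Tendsto (fun j => ∫ y, k y * u j y) atTop (𝓝 (∫ y, k y * f y)) := by
  have hk' : MemLp (fun y => star (k y)) 2 volume := hk.star
  have key : ∀ v : Lp ℂ 2 (volume : Measure (Rn n)),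
      ∫ y, k y * v y = inner ℂ (hk'.toLp _) v := fun v => by
    rw [L2.inner_def]
    refine integral_congr_ae ?_
    filter_upwards [hk'.coeFn_toLp] with y hy
    rw [hy]
    simp [mul_comm]
  simp_rw [key]
  exact tendsto_const_nhds.inner hu

/-- Approximate `f` in `L²` by test functions supported near `S`. Along a subsequence their images
converge almost everywhere to `T f`, while for fixed `x ∈ S'` their integrals converge because the
truncated `K(x, ·)` is in `L²`. -/
theorem CZO.represents {n : ℕ} (hn : 1 ≤ n) {Γ : StandardHyperCurve n} {K : Rn n → Rn n → ℂ}
    (T : CZO Γ K) {V A δ : ℝ} (h : SingularKernel Γ.rho K V A δ) :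
    Represents T.onL2 Γ.rho K := by
  intro f S S' ε hε hf hS
  have hf' : ∀ᵐ y, y ∉ closure S → f y = 0 := by
    filter_upwards [hf] with y hy hyS using hy fun h => hyS (subset_closure h)
  have hS1 : ∀ x ∈ S', ∀ y ∈ closure S, ε ≤ Γ.rho x y := fun x hx y hy =>
    h.le_dist_of_mem_closure hS x (subset_closure hx) y hy
  -- Thickening `S` by `ε / 4` costs at most `ε / 2` of the separation. As `ρ` vanishes on the
  -- curve, this also keeps `x` out of `γ⁻¹` of the supports of the approximants.
  have hS2 : ∀ x ∈ S', ∀ y ∈ Metric.cthickening (ε / 4) (closure S), ε / 2 ≤ Γ.rho x y := by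
    intro x hx y hy
    obtain ⟨z, hz, hyz⟩ := Metric.mem_thickening_iff.1
      (Metric.cthickening_subset_thickening' (half_pos hε) (by linarith) _ hy)
    have h1 := hS1 x hx z hz
    have h2 := h.lipschitz x x z y
    rw [dist_eq_norm, norm_sub_rev] at hyz
    simp only [sub_self, norm_zero, add_zero] at h2
    linarith
  obtain ⟨φ, hφ1, hφ2⟩ := exists_testFunction_tendsto f isClosed_closure hf'
    (show 0 < ε / 4 by positivity)
  obtain ⟨ns, hmono, hns⟩ := (tendstoInMeasure_of_tendsto_Lp
    ((T.onL2.continuous.tendsto f).comp hφ2)).exists_seq_tendsto_ae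
  have hrep := ae_all_iff.2 fun j => T.repr_test (φ j)
  filter_upwards [hns, hrep] with x hx hxr hxS
  have hnot : ∀ j, x ∉ Γ.preimage (tsupport (φ j)) := by
    rintro j ⟨i, hi, hmem⟩
    have := hS2 x hxS _ (hφ1 j hmem)
    rw [Γ.rho_eq_zero hi] at this
    linarith
  have hkL : MemLp ({y | ε / 2 ≤ Γ.rho x y}.indicator (K x)) 2 volume :=
    h.memLp_indicator_right hn x (half_pos hε) (by norm_num)
  have h1 := (tendsto_integral_mul hkL hφ2)
  have h2 : ∀ j, ∫ y, {y | ε / 2 ≤ Γ.rho x y}.indicator (K x) y * testToL2 (φ j) y =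
      T.onL2 (testToL2 (φ j)) x := fun j => by
    rw [hxr j (hnot j)]
    refine integral_congr_ae ?_
    have h3 : ∀ᵐ y, y ∉ Metric.cthickening (ε / 4) (closure S) → φ j y = 0 :=
      ae_of_all _ fun y hy => image_eq_zero_of_notMem_tsupport fun h => hy (hφ1 j h)
    refine EventuallyEq.trans ?_ (SingularKernel.kernel_mul_ae_eq h3 (hS2 x hxS))
    filter_upwards [(testFunction_memLp_two (φ j)).coeFn_toLp] with y hy
    rw [testToL2, hy]
  simp_rw [h2] at h1
  rw [integral_congr_ae (SingularKernel.kernel_mul_ae_eq (K := K) hf'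
    (fun y hy => (half_le_self hε.le).trans (hS1 x hxS y hy)))] at h1
  exact tendsto_nhds_unique hx (h1.comp hmono.tendsto_atTop)

namespace SingularKernel

variable {n : ℕ} {ρ : Rn n → Rn n → ℝ} {K : Rn n → Rn n → ℂ} {V A δ : ℝ}

/-- The integrability behind the duality between `T` and its adjoint. -/
theorem integrable_prod (h : SingularKernel ρ K V A δ) (hn : 1 ≤ n) {ε : ℝ} (hε : 0 < ε)
    {f : Rn n → ℂ} (hf : MemLp f 2 volume) {B : Set (Rn n)} (hB : MeasurableSet B)
    (hBfin : volume B ≠ ∞) :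
    Integrable (fun q : Rn n × Rn n => B.indicator
      (fun _ => {y | ε ≤ ρ q.1 y}.indicator (K q.1) q.2 * f q.2) q.1)
      ((volume : Measure (Rn n)).prod volume) := by
  have hmeas : AEStronglyMeasurable (fun q : Rn n × Rn n => B.indicator
      (fun _ => {y | ε ≤ ρ q.1 y}.indicator (K q.1) q.2 * f q.2) q.1)
      ((volume : Measure (Rn n)).prod volume) := by
    have hm : MeasurableSet {q : Rn n × Rn n | ε ≤ ρ q.1 q.2} :=
      (isClosed_le continuous_const h.continuous_dist).measurableSet
    have h1 := ((h.measurable_indicator.indicator hm).aestronglyMeasurable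
      (μ := (volume : Measure (Rn n)).prod volume)).mul (hf.aestronglyMeasurable.comp_snd
      (μ := (volume : Measure (Rn n))))
    have h2 := h1.indicator (measurable_fst hB)
    convert h2 using 1
    ext q
    by_cases hq : q.1 ∈ B
    · rw [indicator_of_mem hq, indicator_of_mem (show q ∈ Prod.fst ⁻¹' B from hq), Pi.mul_apply]
      by_cases hq' : ε ≤ ρ q.1 q.2
      · rw [indicator_of_mem (show q.2 ∈ {y | ε ≤ ρ q.1 y} from hq'),
          indicator_of_mem (show q ∈ {q : Rn n × Rn n | ε ≤ ρ q.1 q.2} from hq'),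
          indicator_of_mem (show q ∈ {q : Rn n × Rn n | 0 < ρ q.1 q.2} from hε.trans_le hq')]
      · rw [indicator_of_notMem (show q.2 ∉ {y | ε ≤ ρ q.1 y} from hq'),
          indicator_of_notMem (show q ∉ {q : Rn n × Rn n | ε ≤ ρ q.1 q.2} from hq')]
    · rw [indicator_of_notMem hq, indicator_of_notMem (show q ∉ Prod.fst ⁻¹' B from hq)]
  refine ⟨hmeas, ?_⟩
  obtain ⟨C, hC, hKC⟩ : ∃ C : ℝ≥0∞, C ≠ ∞ ∧ ∀ x,
      ∫⁻ y, ‖{y | ε ≤ ρ x y}.indicator (K x) y‖ₑ ^ (2 : ℝ) ≤ C :=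
    ⟨_, by finiteness, fun x => h.lintegral_kernel_rpow_right_le hn x hε one_lt_two⟩
  have hfC : ∫⁻ y, ‖f y‖ₑ ^ (2 : ℝ) < ∞ := by
    have := (eLpNorm_lt_top_iff_lintegral_rpow_enorm_lt_top (by simp) (by simp)).1 hf.2
    simpa using this
  rw [hasFiniteIntegral_def, lintegral_prod _ hmeas.enorm]
  -- By `ab ≤ a² + b²` the inner integral is bounded uniformly in `x ∈ B`, and `B` has finite
  -- measure.
  calc _ ≤ ∫⁻ x, B.indicator (fun _ => C + ∫⁻ y, ‖f y‖ₑ ^ (2 : ℝ)) x := by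
        refine lintegral_mono fun x => ?_
        by_cases hx : x ∈ B
        · simp only [indicator_of_mem hx]
          calc _ ≤ ∫⁻ y, (‖{y | ε ≤ ρ x y}.indicator (K x) y‖ₑ ^ (2 : ℝ) +
                ‖f y‖ₑ ^ (2 : ℝ)) := by
                refine lintegral_mono fun y => ?_
                rw [enorm_mul, ENNReal.rpow_two, ENNReal.rpow_two, sq, sq]
                set a := ‖{y | ε ≤ ρ x y}.indicator (K x) y‖ₑ
                set b := ‖f y‖ₑ
                rcases le_total a b with hab | hab
                · exact (mul_le_mul_left hab b).trans le_add_self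
                · exact (mul_le_mul_right hab a).trans le_self_add
            _ = _ := lintegral_add_left' ((h.aestronglyMeasurable_indicator_right x
                hε).enorm.pow_const _) _
            _ ≤ _ := by gcongr; exact hKC x
        · simp only [indicator_of_notMem hx, enorm_zero, lintegral_zero, le_refl]
    _ = (C + ∫⁻ y, ‖f y‖ₑ ^ (2 : ℝ)) * volume B := by
        rw [lintegral_indicator hB, setLIntegral_const]
    _ < ∞ := ENNReal.mul_lt_top (ENNReal.add_lt_top.2 ⟨hC.lt_top, hfC⟩) hBfin.lt_top

end SingularKernel

/-- For `B ⊆ closure S'` of finite measure, `∫_B T* f = ⟨T 1_B, f⟩`. On `closure S` the function `T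
1_B` is an integral against `K`, so Fubini identifies the pairing with the integral over `B` of the
expected formula; `B` being arbitrary, the two functions agree on `closure S'`. -/
theorem Represents.adjoint {n : ℕ} (hn : 1 ≤ n) {ρ : Rn n → Rn n → ℝ} {K : Rn n → Rn n → ℂ}
    {V A δ : ℝ} (h : SingularKernel ρ K V A δ)
    {T : Lp ℂ 2 (volume : Measure (Rn n)) →L[ℂ] Lp ℂ 2 (volume : Measure (Rn n))}
    (hT : Represents T ρ K) :
    Represents (ContinuousLinearMap.adjoint T) (fun x y => ρ y x) (fun x y => star (K y x)) := by
  intro f S S' ε hε hf hS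
  have h' := h.adjoint
  have hS2 := h'.le_dist_of_mem_closure hS
  have hf' : ∀ᵐ y, y ∉ closure S → f y = 0 := by
    filter_upwards [hf] with y hy hyS using hy fun h => hyS (subset_closure h)
  have hcl : MeasurableSet (closure S') := isClosed_closure.measurableSet
  -- The truncated kernel makes `F` integrable on every set of finite measure, not only inside `S'`;
  -- on `S'` the truncation has no effect.
  obtain ⟨F, hF⟩ : ∃ F : Rn n → ℂ, F = fun x =>
    ∫ y, {y | ε ≤ ρ y x}.indicator (fun y => star (K y x)) y * f y := ⟨_, rfl⟩
  -- integrals over sets of finite measure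
  have hint : ∀ B : Set (Rn n), MeasurableSet B → volume B ≠ ∞ → IntegrableOn F B := by
    intro B hB hBfin
    have h1 := (h'.integrable_prod hn hε (Lp.memLp f) hB hBfin).integral_prod_left
    rw [← integrable_indicator_iff hB]
    refine h1.congr (ae_of_all _ fun x => ?_)
    by_cases hx : x ∈ B
    · simp only [indicator_of_mem hx, hF]
    · simp only [indicator_of_notMem hx, integral_zero]
  have hadj : ∀ B : Set (Rn n), MeasurableSet B → volume B ≠ ∞ → B ⊆ closure S' →
      ∫ x in B, (ContinuousLinearMap.adjoint T f : Rn n → ℂ) x = ∫ x in B, F x := by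
    intro B hB hBfin hBS
    refine (L2.inner_indicatorConstLp_one (𝕜 := ℂ) hB hBfin
      (ContinuousLinearMap.adjoint T f)).symm.trans ?_
    refine (ContinuousLinearMap.adjoint_inner_right T _ f).trans ?_
    refine (L2.inner_def _ _).trans ?_
    have h1 := hT (indicatorConstLp 2 hB hBfin 1) B (closure S) ε hε
      (by
        filter_upwards [indicatorConstLp_coeFn (p := 2) (hs := hB) (hμs := hBfin) (c := (1 : ℂ))]
          with x hx hxB
        rw [hx, indicator_of_notMem hxB])
      (fun y hy x hx => hS2 x (hBS hx) y hy)
    have h2 := integral_integral_swap (f := fun x y => B.indicator (fun _ =>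
        {y | ε ≤ ρ y x}.indicator (fun y => star (K y x)) y * f y) x) (h'.integrable_prod hn hε (Lp.memLp f) hB hBfin)
    have h3 : ∫ x in B, F x = ∫ x, ∫ y, B.indicator (fun _ =>
        {y | ε ≤ ρ y x}.indicator (fun y => star (K y x)) y * f y) x := by
      rw [← integral_indicator hB]
      refine integral_congr_ae (ae_of_all _ fun x => ?_)
      by_cases hx : x ∈ B
      · simp only [indicator_of_mem hx, hF]
      · simp only [indicator_of_notMem hx, integral_zero]
    rw [h3]
    refine Eq.trans ?_ h2.symm
    refine integral_congr_ae ?_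
    filter_upwards [h1, hf'] with y hy hfy
    by_cases hyS : y ∈ closure S
    · rw [hy hyS]
      simp only [RCLike.inner_apply]
      rw [← integral_conj, ← integral_const_mul]
      refine integral_congr_ae ?_
      filter_upwards [indicatorConstLp_coeFn (p := 2) (hs := hB) (hμs := hBfin) (c := (1 : ℂ))]
        with x hx
      rw [hx]
      by_cases hxB : x ∈ B
      · simp only [indicator_of_mem hxB, mul_one]
        rw [indicator_of_mem (show y ∈ {y | ε ≤ ρ y x} from hS2 x (hBS hxB) y hyS), mul_comm]
        rfl
      · simp only [indicator_of_notMem hxB, mul_zero, map_zero]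
    · simp only [hfy hyS, inner_zero_right, mul_zero, indicator_zero, integral_zero]
  have hae : (ContinuousLinearMap.adjoint T f : Rn n → ℂ) =ᵐ[volume.restrict (closure S')] F := by
    refine ae_eq_of_forall_setIntegral_eq_of_sigmaFinite (fun s hs hμs => ?_) (fun s hs hμs => ?_)
      fun s hs hμs => ?_
    all_goals
      rw [Measure.restrict_apply hs] at hμs
      try rw [IntegrableOn]
      simp only [Measure.restrict_restrict hs]
    · have := isFiniteMeasure_restrict.2 hμs.ne
      exact ((Lp.memLp _).restrict _).integrable one_le_two
    · exact hint _ (hs.inter hcl) hμs.ne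
    · exact hadj _ (hs.inter hcl) hμs.ne inter_subset_right
  filter_upwards [(ae_restrict_iff' hcl).1 hae] with x hx hxS
  rw [hx (subset_closure hxS), hF]
  exact integral_congr_ae (SingularKernel.kernel_mul_ae_eq (ρ := fun x y => ρ y x)
    (K := fun x y => star (K y x)) hf (hS x hxS))

/-! ### Dyadic cubes and the Calderón–Zygmund decomposition -/

/-- The index of the dyadic cube of side `2 ^ k` that contains `x`. -/
noncomputable def dyadicIndex {n : ℕ} (k : ℤ) (x : Rn n) : Fin n → ℤ := fun i => ⌊x i / (2 : ℝ) ^ k⌋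

/-- The half-open dyadic cubes of side `2 ^ k`. -/
def dyadicCube {n : ℕ} (k : ℤ) (m : Fin n → ℤ) : Set (Rn n) := {x | dyadicIndex k x = m}

section Dyadic

variable {n : ℕ}

theorem mem_dyadicCube (k : ℤ) (x : Rn n) : x ∈ dyadicCube k (dyadicIndex k x) := rfl

theorem dyadicCube_eq_preimage (k : ℤ) (m : Fin n → ℤ) :
    dyadicCube k m = WithLp.ofLp ⁻¹'
      (univ.pi fun i => Ico ((m i : ℝ) * 2 ^ k) ((m i : ℝ) * 2 ^ k + 2 ^ k)) := by
  ext x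
  have h2 : (0 : ℝ) < 2 ^ k := by positivity
  simp only [dyadicCube, dyadicIndex, mem_ofPred_eq, mem_preimage, mem_univ_pi, mem_Ico, funext_iff]
  refine forall_congr' fun i => ?_
  rw [Int.floor_eq_iff, le_div_iff₀ h2, div_lt_iff₀ h2, add_mul, one_mul]

theorem measurableSet_dyadicCube (k : ℤ) (m : Fin n → ℤ) : MeasurableSet (dyadicCube k m) := by
  rw [dyadicCube_eq_preimage]
  exact (PiLp.volume_preserving_ofLp (Fin n)).measurable
    (MeasurableSet.univ_pi fun _ => measurableSet_Ico)

theorem volume_dyadicCube (k : ℤ) (m : Fin n → ℤ) :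
    volume (dyadicCube k m) = ENNReal.ofReal (((2 : ℝ) ^ k) ^ n) := by
  rw [dyadicCube_eq_preimage, (PiLp.volume_preserving_ofLp (Fin n)).measure_preimage
    (MeasurableSet.univ_pi fun _ => measurableSet_Ico).nullMeasurableSet, Real.volume_pi_Ico]
  simp only [add_sub_cancel_left, Finset.prod_const, Finset.card_univ, Fintype.card_fin]
  rw [ENNReal.ofReal_pow (by positivity)]

/-- Nestedness of the dyadic grids: the index at scale `k + d` is the integer quotient by `2 ^ d` of
the index at scale `k`. -/
theorem dyadicIndex_eq_of_le {k j : ℤ} (hkj : k ≤ j) {x y : Rn n}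
    (h : dyadicIndex k x = dyadicIndex k y) : dyadicIndex j x = dyadicIndex j y := by
  obtain ⟨d, rfl⟩ := Int.le.dest hkj
  have key : ∀ z : Rn n, ∀ i, dyadicIndex (k + d) z i = dyadicIndex k z i / ((2 ^ d : ℕ) : ℤ) := by
    intro z i
    simp only [dyadicIndex]
    rw [← Int.floor_div_natCast, zpow_add₀ (by norm_num), div_div]
    norm_cast
  funext i
  rw [key, key, h]

theorem norm_sub_le_of_mem_dyadicCube {k : ℤ} {m : Fin n → ℤ} {x y : Rn n}
    (hx : x ∈ dyadicCube k m) (hy : y ∈ dyadicCube k m) : ‖x - y‖ ≤ n * 2 ^ k := by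
  rw [dyadicCube_eq_preimage] at hx hy
  simp only [mem_preimage, mem_univ_pi, mem_Ico] at hx hy
  have h2 : (0 : ℝ) < 2 ^ k := by positivity
  rw [EuclideanSpace.norm_eq, Real.sqrt_le_iff]
  refine ⟨by positivity, ?_⟩
  calc ∑ i, ‖(x - y) i‖ ^ 2 ≤ ∑ _i : Fin n, ((2 : ℝ) ^ k) ^ 2 := by
        refine Finset.sum_le_sum fun i _ => ?_
        gcongr
        rw [PiLp.sub_apply, Real.norm_eq_abs, abs_le]
        constructor <;> linarith [(hx i).1, (hx i).2, (hy i).1, (hy i).2]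
    _ = n * ((2 : ℝ) ^ k) ^ 2 := by simp
    _ ≤ (n * 2 ^ k) ^ 2 := by
        rw [mul_pow]
        gcongr
        have : n ≤ n ^ 2 := Nat.le_self_pow two_ne_zero n
        exact_mod_cast this

/-- If the averages of `w` over all dyadic cubes that contain `x` are at most 1, then `w x ≤ 1`,
almost everywhere. -/
theorem ae_le_one_of_dyadic (hn : 1 ≤ n) {w : Rn n → ℝ} (hw0 : ∀ x, 0 ≤ w x)
    (hw : Integrable w volume) :
    ∀ᵐ x, (∀ k : ℤ, ∫⁻ y in dyadicCube k (dyadicIndex k x), ENNReal.ofReal (w y) ≤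
      volume (dyadicCube k (dyadicIndex k x))) → w x ≤ 1 := by
  filter_upwards [IsUnifLocDoublingMeasure.ae_tendsto_average_norm_sub (volume : Measure (Rn n))
    hw.locallyIntegrable 1] with x hx hgood
  have hn0 : (0 : ℝ) < n := by exact_mod_cast hn
  set v := (volume (Metric.ball (0 : Rn n) 1)).toReal
  have hδ : Tendsto (fun j : ℕ => (n : ℝ) * 2 ^ (-(j : ℤ))) atTop (𝓝[>] 0) := by
    refine tendsto_nhdsWithin_iff.2 ⟨?_, Eventually.of_forall fun j => ?_⟩
    · have := (tendsto_pow_atTop_nhds_zero_of_lt_one (r := (1 / 2 : ℝ)) (by norm_num)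
        (by norm_num)).const_mul (n : ℝ)
      simpa using this
    · have : (0 : ℝ) < n * 2 ^ (-(j : ℤ)) := by positivity
      exact this
  have hlim := hx (l := atTop) (fun _ : ℕ => x) (fun j : ℕ => (n : ℝ) * 2 ^ (-(j : ℤ))) hδ
    (Eventually.of_forall fun j => Metric.mem_closedBall_self (by positivity))
  -- The cube of side `2 ^ (-j)` around `x` lies in the ball of radius `n * 2 ^ (-j)`, and the ratio
  -- of volumes is `n ^ n * v` for every `j`. The mean of `w` over the cube is at most 1 and its
  -- distance from `w x` is at most this ratio times the mean oscillation over the ball, which tends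
  -- to zero at Lebesgue points.
  have hbound : ∀ j : ℕ, w x ≤ 1 + n ^ n * v *
      ⨍ y in Metric.closedBall x (n * 2 ^ (-(j : ℤ))), ‖w y - w x‖ := by
    intro j
    set k : ℤ := -(j : ℤ)
    set B := Metric.closedBall x ((n : ℝ) * 2 ^ k)
    set Q := dyadicCube k (dyadicIndex k x)
    have hQB : Q ⊆ B := fun y hy => by
      rw [Metric.mem_closedBall, dist_eq_norm]
      exact norm_sub_le_of_mem_dyadicCube hy (mem_dyadicCube k x)
    have hQm : MeasurableSet Q := measurableSet_dyadicCube _ _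
    have h2 : (0 : ℝ) < 2 ^ k := by positivity
    have hQv : volume.real Q = ((2 : ℝ) ^ k) ^ n := by
      rw [Measure.real, volume_dyadicCube, ENNReal.toReal_ofReal (by positivity)]
    have hBv : volume.real B = n ^ n * ((2 : ℝ) ^ k) ^ n * v := by
      rw [Measure.real, Measure.addHaar_closedBall _ _ (by positivity), ENNReal.toReal_mul,
        ENNReal.toReal_ofReal (by positivity), finrank_euclideanSpace_fin, mul_pow]
    have hBfin : volume B ≠ ∞ := measure_closedBall_lt_top.ne
    have hQfin : volume Q ≠ ∞ := ((measure_mono hQB).trans_lt hBfin.lt_top).ne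
    have hdiff : IntegrableOn (fun y => ‖w y - w x‖) B :=
      ((hw.integrableOn).sub (integrableOn_const hBfin)).norm
    have h3 : ∫ y in Q, w y ≤ volume.real Q := by
      rw [Measure.real, integral_eq_lintegral_of_nonneg_ae (ae_of_all _ hw0)
        hw.aestronglyMeasurable.restrict]
      exact ENNReal.toReal_mono hQfin (hgood k)
    have h4 : volume.real Q * w x - ∫ y in Q, w y ≤ ∫ y in Q, ‖w y - w x‖ := by
      have hc : IntegrableOn (fun _ => w x) Q := integrableOn_const hQfin
      rw [← smul_eq_mul, ← setIntegral_const, ← integral_sub hc hw.integrableOn]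
      refine setIntegral_mono_on (hc.sub hw.integrableOn)
        (hdiff.mono_set hQB) hQm fun y _ => ?_
      rw [norm_sub_rev]
      exact Real.le_norm_self _
    have h5 : ∫ y in Q, ‖w y - w x‖ ≤ ∫ y in B, ‖w y - w x‖ :=
      setIntegral_mono_set hdiff (ae_of_all _ fun _ => norm_nonneg _)
        (LE.le.eventuallyLE hQB)
    have h6 : ∫ y in B, ‖w y - w x‖ = volume.real B * ⨍ y in B, ‖w y - w x‖ := by
      rw [← smul_eq_mul, measure_smul_setAverage _ hBfin]
    rw [h6, hBv] at h5
    rw [hQv] at h3 h4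
    have hpos : (0 : ℝ) < (2 ^ k) ^ n := by positivity
    have : ((2 : ℝ) ^ k) ^ n * w x ≤
        (2 ^ k) ^ n * (1 + n ^ n * v * ⨍ y in B, ‖w y - w x‖) := by
      nlinarith
    exact le_of_mul_le_mul_left this hpos
  have := (hlim.const_mul ((n : ℝ) ^ n * v)).const_add 1
  rw [mul_zero, add_zero] at this
  exact ge_of_tendsto' this hbound

/-- The Calderón–Zygmund cubes of a nonnegative integrable function, at height 1. -/
theorem exists_calderonZygmund_cubes (hn : 1 ≤ n) {w : Rn n → ℝ} (hw0 : ∀ x, 0 ≤ w x)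
    (hw : Integrable w volume) :
    ∃ (ι : Type) (_ : Countable ι) (Q : ι → Set (Rn n)) (c : ι → Rn n) (s : ι → ℝ),
      (∀ i, MeasurableSet (Q i)) ∧ Pairwise (Function.onFun Disjoint Q) ∧
      (∀ i, 0 < s i) ∧ (∀ i, ∀ x ∈ Q i, ‖x - c i‖ ≤ s i) ∧
      (∀ i, ENNReal.ofReal (s i ^ n) = ENNReal.ofReal (n ^ n) * volume (Q i)) ∧
      (∀ i, volume (Q i) ≤ ∫⁻ y in Q i, ENNReal.ofReal (w y)) ∧
      (∀ i, ∫⁻ y in Q i, ENNReal.ofReal (w y) ≤ 2 ^ n * volume (Q i)) ∧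
      ∀ᵐ x, x ∉ ⋃ i, Q i → w x ≤ 1 := by
  have hn0 : (0 : ℝ) < n := by exact_mod_cast hn
  let bad : ℤ → (Fin n → ℤ) → Prop := fun k m =>
    volume (dyadicCube k m) < ∫⁻ y in dyadicCube k m, ENNReal.ofReal (w y)
  -- The maximal bad cubes. By nestedness, any point of a cube determines all the coarser cubes that
  -- contain it, so one witness `x` suffices.
  let I : Set (ℤ × (Fin n → ℤ)) := {q | bad q.1 q.2 ∧
    ∃ x, dyadicIndex q.1 x = q.2 ∧ ∀ j, q.1 < j → ¬ bad j (dyadicIndex j x)}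
  have hfin : ∫⁻ y, ENNReal.ofReal (w y) ≠ ∞ := by
    rw [← ofReal_integral_eq_lintegral_ofReal hw (ae_of_all _ hw0)]
    exact ENNReal.ofReal_ne_top
  choose c hc hmax using fun q : I => q.2.2
  refine ⟨I, inferInstance, fun q => dyadicCube q.1.1 q.1.2, c, fun q => n * 2 ^ q.1.1,
    fun q => measurableSet_dyadicCube _ _, fun q q' hqq' => ?_, fun q => by positivity,
    fun q x hx => norm_sub_le_of_mem_dyadicCube hx (hc q), fun q => ?_, fun q => q.2.1.le,
    fun q => ?_, ?_⟩
  · rw [Function.onFun, disjoint_left]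
    intro x hx hx'
    have main : ∀ q q' : I, x ∈ dyadicCube q.1.1 q.1.2 → x ∈ dyadicCube q'.1.1 q'.1.2 →
        ¬ q.1.1 < q'.1.1 := by
      intro q q' hx hx' hlt
      have h1 : dyadicIndex q'.1.1 (c q) = q'.1.2 := by
        rw [← hx']
        exact dyadicIndex_eq_of_le hlt.le ((hc q).trans hx.symm)
      exact hmax q _ hlt (h1 ▸ q'.2.1)
    have heq : q.1.1 = q'.1.1 :=
      le_antisymm (not_lt.1 (main q' q hx' hx)) (not_lt.1 (main q q' hx hx'))
    refine hqq' (Subtype.ext (Prod.ext heq ?_))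
    rw [← hx, ← hx', heq]
  · rw [volume_dyadicCube, ← ENNReal.ofReal_mul (by positivity), mul_pow]
  -- The parent of a maximal bad cube is not bad, and its volume is `2 ^ n` times larger.
  · have hlt : q.1.1 < q.1.1 + 1 := lt_add_one _
    have hsub : dyadicCube q.1.1 q.1.2 ⊆
        dyadicCube (q.1.1 + 1) (dyadicIndex (q.1.1 + 1) (c q)) := fun x hx =>
      dyadicIndex_eq_of_le hlt.le (hx.trans (hc q).symm)
    refine (lintegral_mono_set hsub).trans ((not_lt.1 (hmax q _ hlt)).trans_eq ?_)
    rw [volume_dyadicCube, volume_dyadicCube, zpow_add_one₀ two_ne_zero, mul_pow, mul_comm,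
      ENNReal.ofReal_mul (by positivity), ENNReal.ofReal_pow (by norm_num)]
    norm_num
  · filter_upwards [ae_le_one_of_dyadic hn hw0 hw] with x hx hxQ
    refine hx fun k => not_lt.1 fun hk => hxQ ?_
    obtain ⟨m, hm, hm'⟩ := Int.exists_greatest_of_bdd
      (P := fun k => bad k (dyadicIndex k x)) (by
        -- Bad cubes have bounded scale: for `z ≥ 0`, `z ≤ 2 ^ z ≤ (2 ^ z) ^ n`, and this volume is
        -- below the total integral of `w`. So each bad cube around `x` lies in a maximal one.
        refine ⟨max 0 ⌈(∫⁻ y, ENNReal.ofReal (w y)).toReal⌉, fun z hz => ?_⟩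
        rcases le_total z 0 with h0 | h0
        · exact h0.trans (le_max_left _ _)
        · refine le_trans ?_ (le_max_right _ _)
          have h1 : volume (dyadicCube z (dyadicIndex z x)) ≤ ∫⁻ y, ENNReal.ofReal (w y) :=
            (le_of_lt hz).trans (setLIntegral_le_lintegral _ _)
          rw [volume_dyadicCube, ENNReal.ofReal_le_iff_le_toReal hfin] at h1
          have h2 : (z : ℝ) ≤ (∫⁻ y, ENNReal.ofReal (w y)).toReal := by
            refine le_trans ?_ h1
            obtain ⟨d, rfl⟩ := Int.eq_ofNat_of_zero_le h0
            have h3 : ((d : ℕ) : ℝ) ≤ 2 ^ d := by exact_mod_cast Nat.lt_two_pow_self.le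
            have h4 : (1 : ℝ) ≤ 2 ^ d := one_le_pow₀ (by norm_num)
            have h5 := le_self_pow₀ h4 (show n ≠ 0 by omega)
            push_cast
            rw [zpow_natCast]
            linarith
          exact_mod_cast h2.trans (Int.le_ceil _)) ⟨k, hk⟩
    refine mem_iUnion.2 ⟨⟨(m, dyadicIndex m x), hm, x, rfl, fun j hj hbad => ?_⟩, rfl⟩
    exact absurd (hm' j hbad) (not_le.2 hj)

end Dyadic

/-! ### Weak type inequality for `1 ≤ p ≤ 2` -/

section WeakType

variable {n : ℕ}

theorem coeFn_finsetSum_Lp {ι : Type*} (F : Finset ι)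
    (f : ι → Lp ℂ 2 (volume : Measure (Rn n))) :
    (∑ i ∈ F, f i : Lp ℂ 2 (volume : Measure (Rn n))) =ᵐ[volume] fun x => ∑ i ∈ F, f i x := by
  classical
  induction F using Finset.induction_on with
  | empty =>
    simp only [Finset.sum_empty]
    exact Lp.coeFn_zero ℂ 2 (volume : Measure (Rn n))
  | insert i F hi ih =>
    rw [Finset.sum_insert hi]
    filter_upwards [Lp.coeFn_add (f i) (∑ i ∈ F, f i), ih] with x h1 h2
    rw [h1, Pi.add_apply, h2, Finset.sum_insert hi]

theorem enorm_sq_eq_lintegral (v : Lp ℂ 2 (volume : Measure (Rn n))) :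
    ‖v‖ₑ ^ 2 = ∫⁻ x, ‖v x‖ₑ ^ 2 := by
  have := eLpNorm_nnreal_pow_eq_lintegral (f := v) (μ := volume) (p := 2) two_ne_zero
  rw [Lp.enorm_def]
  simpa using this

theorem lintegral_enorm_sq_map_le
    (T : Lp ℂ 2 (volume : Measure (Rn n)) →L[ℂ] Lp ℂ 2 (volume : Measure (Rn n)))
    (v : Lp ℂ 2 (volume : Measure (Rn n))) :
    ∫⁻ x, ‖T v x‖ₑ ^ 2 ≤ ‖T‖ₑ ^ 2 * ∫⁻ x, ‖v x‖ₑ ^ 2 := by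
  rw [← enorm_sq_eq_lintegral, ← enorm_sq_eq_lintegral, ← mul_pow]
  gcongr
  exact T.le_opENorm v

theorem volume_one_lt_enorm_map_le
    (T : Lp ℂ 2 (volume : Measure (Rn n)) →L[ℂ] Lp ℂ 2 (volume : Measure (Rn n)))
    (v : Lp ℂ 2 (volume : Measure (Rn n))) :
    volume {x | 1 < ‖T v x‖ₑ} ≤ ‖T‖ₑ ^ 2 * ∫⁻ x, ‖v x‖ₑ ^ 2 := by
  refine le_trans ?_ (lintegral_enorm_sq_map_le T v)
  have h1 := mul_meas_ge_le_lintegral₀ (μ := volume) (f := fun x => ‖T v x‖ₑ ^ 2)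
    ((Lp.aestronglyMeasurable (T v)).enorm.pow_const 2) 1
  rw [one_mul] at h1
  refine (measure_mono fun x hx => ?_).trans h1
  exact one_le_pow₀ (M₀ := ℝ≥0∞) (le_of_lt hx)

variable {ρ : Rn n → Rn n → ℝ} {K : Rn n → Rn n → ℂ} {V A δ : ℝ}
  {T : Lp ℂ 2 (volume : Measure (Rn n)) →L[ℂ] Lp ℂ 2 (volume : Measure (Rn n))}

/-- The image of a function of mean zero is integrable away from the singularities. -/
theorem Represents.lintegral_le_of_integral_eq_zero (hn : 1 ≤ n) (h : SingularKernel ρ K V A δ)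
    (hT : Represents T ρ K) {b : Lp ℂ 2 (volume : Measure (Rn n))} {Q : Set (Rn n)} {c : Rn n}
    {s : ℝ} (hs : 0 < s) (hQ : ∀ y ∈ Q, ‖y - c‖ ≤ s) (hb : ∀ᵐ y, y ∉ Q → b y = 0)
    (hb1 : Integrable b volume) (hb0 : ∫ y, b y = 0) :
    ∫⁻ x in {x | 2 * s ≤ ρ x c}, ‖T b x‖ₑ ≤
      ENNReal.ofReal (A * (V * ((n + δ) / δ * 2 ^ (-δ)))) * ∫⁻ y, ‖b y‖ₑ := by
  have hδ := h.δ_pos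
  have hA := h.A_nonneg
  have hSm : MeasurableSet {x | 2 * s ≤ ρ x c} := (h.isClosed_le_dist_left c (2 * s)).measurableSet
  have hfar : ∀ x ∈ {x | 2 * s ≤ ρ x c}, ∀ y ∈ Q, s ≤ ρ x y := by
    intro x hx y hy
    have h1 := h.lipschitz x x c y
    have h2 := hQ y hy
    rw [sub_self, norm_zero, add_zero, norm_sub_rev] at h1
    have hx : 2 * s ≤ ρ x c := hx
    linarith
  have hpt : ∀ᵐ x, x ∈ {x | 2 * s ≤ ρ x c} → ‖T b x‖ₑ ≤
      ENNReal.ofReal (A * s ^ δ) * ENNReal.ofReal (ρ x c ^ (-((n : ℝ) + δ))) * ∫⁻ y, ‖b y‖ₑ := by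
    filter_upwards [hT b Q _ s hs hb hfar] with x hx hxS
    have hr : 2 * s ≤ ρ x c := hxS
    have hr0 : 0 < ρ x c := by linarith
    have hint := h.integrable_kernel_mul hn hs (p := 2) (by norm_num) (by simp) (Lp.memLp b) hb
      (hfar x hxS)
    -- The mean of `b` is zero, so `K(x, c)` may be subtracted; the regularity estimate applies
    -- since `‖y - c‖ ≤ s ≤ ρ(x, c) / 2`.
    have heq : T b x = ∫ y, (K x y * b y - K x c * b y) := by
      rw [hx hxS, integral_sub hint (hb1.const_mul _), integral_const_mul, hb0, mul_zero, sub_zero]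
    rw [heq]
    refine (enorm_integral_le_lintegral_enorm _).trans ?_
    rw [← lintegral_const_mul'' _ hb1.aestronglyMeasurable.enorm]
    refine lintegral_mono_ae ?_
    filter_upwards [hb] with y hy
    by_cases hyQ : y ∈ Q
    · rw [← sub_mul, enorm_mul]
      gcongr
      rw [← ENNReal.ofReal_mul (by positivity), ← ofReal_norm]
      refine ENNReal.ofReal_le_ofReal ?_
      have h1 : ‖c - y‖ ≤ s := by rw [norm_sub_rev]; exact hQ y hyQ
      rw [norm_sub_rev, Real.rpow_neg hr0.le, ← div_eq_mul_inv]
      refine (h.reg_right x c y hr0 (by linarith)).trans ?_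
      gcongr
    · simp [hy hyQ]
  calc ∫⁻ x in {x | 2 * s ≤ ρ x c}, ‖T b x‖ₑ
      ≤ ∫⁻ x in {x | 2 * s ≤ ρ x c}, ENNReal.ofReal (A * s ^ δ) *
          ENNReal.ofReal (ρ x c ^ (-((n : ℝ) + δ))) * ∫⁻ y, ‖b y‖ₑ :=
        lintegral_mono_ae ((ae_restrict_iff' hSm).2 hpt)
    _ = ENNReal.ofReal (A * s ^ δ) * (∫⁻ x in {x | 2 * s ≤ ρ x c},
          ENNReal.ofReal (ρ x c ^ (-((n : ℝ) + δ)))) * ∫⁻ y, ‖b y‖ₑ := by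
        rw [lintegral_mul_const' _ _ hb1.2.ne, lintegral_const_mul' _ _ ENNReal.ofReal_ne_top]
    _ ≤ ENNReal.ofReal (A * s ^ δ) * ENNReal.ofReal (V * (((n : ℝ) + δ) / (((n : ℝ) + δ) - n) *
          (2 * s) ^ ((n : ℝ) - ((n : ℝ) + δ)))) * ∫⁻ y, ‖b y‖ₑ := by
        gcongr
        exact h.lintegral_dist_rpow_left_le c (by linarith) (by linarith)
    _ = _ := by
        -- The gain `s ^ δ` from regularity cancels the `s ^ (-δ)` from the integral of `ρ ^ (-(n +
        -- δ))`: the constant does not depend on the size of the cube.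
        rw [← ENNReal.ofReal_mul (by positivity)]
        congr 2
        have h1 : (n : ℝ) - ((n : ℝ) + δ) = -δ := by ring
        have h2 : (n : ℝ) + δ - n = δ := by ring
        rw [h1, h2, Real.mul_rpow (by norm_num) hs.le]
        have h3 : s ^ δ * s ^ (-δ) = 1 := by
          rw [← Real.rpow_add hs, add_neg_cancel, Real.rpow_zero]
        linear_combination (A * (V * (((n : ℝ) + δ) / δ * 2 ^ (-δ)))) * h3

/-- Takes the place of Hölder's inequality on the cubes: a bound for the mean of `|u|^p` becomes one
for the mean of `|u|`. -/
theorem ENNReal.le_one_add_rpow {p : ℝ} (hp : 1 ≤ p) (x : ℝ≥0∞) : x ≤ 1 + x ^ p := by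
  rcases le_total x 1 with h | h
  · exact h.trans le_self_add
  · calc x = x ^ (1 : ℝ) := (ENNReal.rpow_one x).symm
      _ ≤ x ^ p := ENNReal.rpow_le_rpow_of_exponent_le h hp
      _ ≤ _ := le_add_self

/-- The norm of an average. -/
theorem enorm_setAverage_le {u : Rn n → ℂ} {Q : Set (Rn n)} (hQ : volume Q ≠ ∞)
    (hQ0 : volume Q ≠ 0) {D : ℝ≥0∞} (hu : ∫⁻ y in Q, ‖u y‖ₑ ≤ D * volume Q) :
    ‖⨍ y in Q, u y‖ₑ ≤ D := by
  have h1 := measure_smul_setAverage u hQ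
  have h2 : volume Q * ‖⨍ y in Q, u y‖ₑ ≤ volume Q * D := by
    calc volume Q * ‖⨍ y in Q, u y‖ₑ = ‖volume.real Q • ⨍ y in Q, u y‖ₑ := by
          rw [enorm_smul, Measure.real, Real.enorm_of_nonneg ENNReal.toReal_nonneg,
            ENNReal.ofReal_toReal hQ]
      _ ≤ ∫⁻ y in Q, ‖u y‖ₑ := by rw [h1]; exact enorm_integral_le_lintegral_enorm _
      _ ≤ _ := hu.trans_eq (mul_comm _ _)
  exact (ENNReal.mul_le_mul_iff_right hQ0 hQ).1 h2

theorem sum_indicator_of_mem {ι E : Type*} [AddCommMonoid E] {Q : ι → Set (Rn n)}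
    (hd : Pairwise (Function.onFun Disjoint Q)) (F : Finset ι) (φ : ι → Rn n → E) {i : ι}
    {x : Rn n} (hx : x ∈ Q i) (hi : i ∈ F) : ∑ j ∈ F, (Q j).indicator (φ j) x = φ i x := by
  rw [Finset.sum_eq_single_of_mem i hi, indicator_of_mem hx]
  intro j _ hji
  exact indicator_of_notMem (fun hxj => disjoint_left.1 (hd hji) hxj hx) _

theorem sum_indicator_of_notMem {ι E : Type*} [AddCommMonoid E] {Q : ι → Set (Rn n)}
    (F : Finset ι) (φ : ι → Rn n → E) {x : Rn n} (hx : ∀ i ∈ F, x ∉ Q i) :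
    ∑ j ∈ F, (Q j).indicator (φ j) x = 0 :=
  Finset.sum_eq_zero fun j hj => indicator_of_notMem (hx j hj) _

end WeakType

section WeakType

variable {n : ℕ} {ρ : Rn n → Rn n → ℝ} {K : Rn n → Rn n → ℂ} {V A δ : ℝ}
  {T : Lp ℂ 2 (volume : Measure (Rn n)) →L[ℂ] Lp ℂ 2 (volume : Measure (Rn n))}

/-- The contribution of the bad part of a Calderón–Zygmund decomposition. -/
theorem Represents.volume_one_lt_enorm_sum_le (hn : 1 ≤ n) (h : SingularKernel ρ K V A δ)
    (hT : Represents T ρ K) {ι : Type*} (F : Finset ι) (Q : ι → Set (Rn n)) (c : ι → Rn n)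
    (s : ι → ℝ) (b : ι → Lp ℂ 2 (volume : Measure (Rn n))) (D : ℝ≥0∞)
    (hs : ∀ i, 0 < s i) (hQ : ∀ i, ∀ y ∈ Q i, ‖y - c i‖ ≤ s i)
    (hsQ : ∀ i, ENNReal.ofReal (s i ^ n) = ENNReal.ofReal (n ^ n) * volume (Q i))
    (hb : ∀ i, ∀ᵐ y, y ∉ Q i → b i y = 0) (hb1 : ∀ i, Integrable (b i) volume)
    (hb0 : ∀ i, ∫ y, b i y = 0) (hbD : ∀ i, ∫⁻ y, ‖b i y‖ₑ ≤ D * volume (Q i)) :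
    volume {x | 1 < ‖T (∑ i ∈ F, b i) x‖ₑ} ≤
      (ENNReal.ofReal (V * 2 ^ n) * ENNReal.ofReal (n ^ n) +
        ENNReal.ofReal (A * (V * ((n + δ) / δ * 2 ^ (-δ)))) * D) * ∑ i ∈ F, volume (Q i) := by
  have hV := h.V_nonneg
  -- These sets play the role of the dilated cubes. They need not be near `Q i`, being
  -- neighbourhoods of the points that the curve relates to `c i`, but their measure is at most a
  -- constant times that of `Q i`.
  set E : ι → Set (Rn n) := fun i => {x | ρ x (c i) ≤ 2 * s i}
  set G : Set (Rn n) := ⋂ i ∈ F, {x | 2 * s i ≤ ρ x (c i)} with hG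
  have hGm : MeasurableSet G := Finset.measurableSet_biInter F fun i _ =>
    (h.isClosed_le_dist_left (c i) (2 * s i)).measurableSet
  have hE : ∀ i, volume (E i) ≤
      ENNReal.ofReal (V * 2 ^ n) * ENNReal.ofReal (n ^ n) * volume (Q i) := fun i => by
    refine (h.volume_left (c i) (2 * s i) (by linarith [hs i])).trans_eq ?_
    rw [mul_pow, ← mul_assoc, ENNReal.ofReal_mul (by positivity), hsQ, mul_assoc]
  have hcov : {x | 1 < ‖T (∑ i ∈ F, b i) x‖ₑ} ⊆
      (⋃ i ∈ F, E i) ∪ ({x | 1 ≤ ‖T (∑ i ∈ F, b i) x‖ₑ} ∩ G) := by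
    intro x hx
    by_cases hxE : x ∈ ⋃ i ∈ F, E i
    · exact Or.inl hxE
    · have hx1 : 1 < ‖T (∑ i ∈ F, b i) x‖ₑ := hx
      refine Or.inr ⟨hx1.le, mem_iInter₂.2 fun i hi => ?_⟩
      by_contra hlt
      have hlt' : ρ x (c i) < 2 * s i := not_le.1 hlt
      exact hxE (mem_iUnion₂.2 ⟨i, hi, hlt'.le⟩)
  have hcheb : volume ({x | 1 ≤ ‖T (∑ i ∈ F, b i) x‖ₑ} ∩ G) ≤
      ∫⁻ x in G, ‖T (∑ i ∈ F, b i) x‖ₑ := by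
    rw [← Measure.restrict_apply' hGm]
    have := mul_meas_ge_le_lintegral₀ (μ := volume.restrict G)
      (f := fun x => ‖T (∑ i ∈ F, b i) x‖ₑ)
      (Lp.aestronglyMeasurable (T (∑ i ∈ F, b i))).enorm.restrict 1
    rwa [one_mul] at this
  have hsum : ∫⁻ x in G, ‖T (∑ i ∈ F, b i) x‖ₑ ≤ ∑ i ∈ F, ∫⁻ x in G, ‖T (b i) x‖ₑ := by
    rw [← lintegral_finsetSum' F fun i _ => (Lp.aestronglyMeasurable (T (b i))).enorm.restrict,
      map_sum]
    refine lintegral_mono_ae (ae_restrict_of_ae ?_)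
    filter_upwards [coeFn_finsetSum_Lp F fun i => T (b i)] with x hx
    rw [hx]
    exact enorm_sum_le _ _
  have hone : ∀ i ∈ F, ∫⁻ x in G, ‖T (b i) x‖ₑ ≤
      ENNReal.ofReal (A * (V * ((n + δ) / δ * 2 ^ (-δ)))) * D * volume (Q i) := fun i hi => by
    refine (lintegral_mono_set (biInter_subset_of_mem (s := (F : Set ι)) hi)).trans
      ((hT.lintegral_le_of_integral_eq_zero hn h (hs i) (hQ i) (hb i) (hb1 i) (hb0 i)).trans ?_)
    rw [mul_assoc]
    gcongr
    exact hbD i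
  calc volume {x | 1 < ‖T (∑ i ∈ F, b i) x‖ₑ}
      ≤ volume (⋃ i ∈ F, E i) + volume ({x | 1 ≤ ‖T (∑ i ∈ F, b i) x‖ₑ} ∩ G) :=
        (measure_mono hcov).trans (measure_union_le _ _)
    _ ≤ ∑ i ∈ F, ENNReal.ofReal (V * 2 ^ n) * ENNReal.ofReal (n ^ n) * volume (Q i) +
          ∑ i ∈ F, ENNReal.ofReal (A * (V * ((n + δ) / δ * 2 ^ (-δ)))) * D * volume (Q i) := by
        gcongr
        · exact (measure_biUnion_finset_le F E).trans (Finset.sum_le_sum fun i _ => hE i)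
        · exact hcheb.trans (hsum.trans (Finset.sum_le_sum hone))
    _ = _ := by rw [← Finset.mul_sum, ← Finset.mul_sum, add_mul]

set_option maxHeartbeats 2000000 in
/-- The weak type `(p, p)` inequality for `1 ≤ p ≤ 2`, at a fixed height. -/
theorem Represents.exists_weakType_of_le_two (hn : 1 ≤ n) (h : SingularKernel ρ K V A δ)
    (hT : Represents T ρ K) {p : ℝ} (hp1 : 1 ≤ p) (hp2 : p ≤ 2) :
    ∃ C : ℝ≥0∞, C ≠ ∞ ∧ ∀ u : Lp ℂ 2 (volume : Measure (Rn n)), ∫⁻ x, ‖u x‖ₑ ^ p ≠ ∞ →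
      volume {x | 3 < ‖T u x‖ₑ} ≤ C * ∫⁻ x, ‖u x‖ₑ ^ p := by
  have hp0 : 0 < p := by linarith
  set D : ℝ≥0∞ := 1 + 2 ^ n with hD
  have hDfin : D ≠ ∞ := by finiteness
  set C₁ : ℝ≥0∞ := ENNReal.ofReal (V * 2 ^ n) * ENNReal.ofReal (n ^ n) +
    ENNReal.ofReal (A * (V * ((n + δ) / δ * 2 ^ (-δ)))) * (D + D) with hC₁
  have hTfin : ‖T‖ₑ ^ 2 ≠ ∞ := ENNReal.pow_ne_top enorm_ne_top
  refine ⟨‖T‖ₑ ^ 2 * (1 + D ^ 2) + C₁, by finiteness, fun u hu => ?_⟩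
  set M := ∫⁻ x, ‖u x‖ₑ ^ p with hM
  have hum : AEStronglyMeasurable u volume := Lp.aestronglyMeasurable u
  have hofReal : ∀ x, ENNReal.ofReal (‖u x‖ ^ p) = ‖u x‖ₑ ^ p := fun x => by
    rw [← ofReal_norm, ENNReal.ofReal_rpow_of_nonneg (norm_nonneg _) hp0.le]
  have hw : Integrable (fun x => ‖u x‖ ^ p) volume := by
    refine ⟨(hum.norm.aemeasurable.pow_const p).aestronglyMeasurable, ?_⟩
    rw [hasFiniteIntegral_iff_ofReal (ae_of_all _ fun x => by positivity)]
    simp_rw [hofReal]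
    exact hu.lt_top
  obtain ⟨ι, hι, Q, c, s, hQm, hQd, hs, hQs, hsQ, hQ1, hQ2, hQ3⟩ :=
    exists_calderonZygmund_cubes hn (fun x => by positivity) hw
  simp_rw [hofReal] at hQ1 hQ2
  set U := ⋃ i, Q i with hU
  have hUm : MeasurableSet U := MeasurableSet.iUnion hQm
  have hvolU : ∑' i, volume (Q i) ≤ M := by
    calc ∑' i, volume (Q i) ≤ ∑' i, ∫⁻ x in Q i, ‖u x‖ₑ ^ p := ENNReal.tsum_le_tsum hQ1
      _ = ∫⁻ x in U, ‖u x‖ₑ ^ p := (lintegral_iUnion hQm hQd _).symm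
      _ ≤ M := setLIntegral_le_lintegral _ _
  have hQfin : ∀ i, volume (Q i) ≠ ∞ := fun i =>
    (((ENNReal.le_tsum i).trans hvolU).trans_lt hu.lt_top).ne
  have hQpos : ∀ i, volume (Q i) ≠ 0 := fun i h0 => by
    have h1 := hsQ i
    rw [h0, mul_zero, ENNReal.ofReal_eq_zero] at h1
    exact (pow_pos (hs i) n).not_ge h1
  have hQD : ∀ i, ∫⁻ y in Q i, ‖u y‖ₑ ≤ D * volume (Q i) := fun i => by
    calc ∫⁻ y in Q i, ‖u y‖ₑ ≤ ∫⁻ y in Q i, (1 + ‖u y‖ₑ ^ p) :=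
          lintegral_mono fun y => ENNReal.le_one_add_rpow hp1 _
      _ = volume (Q i) + ∫⁻ y in Q i, ‖u y‖ₑ ^ p := by
          rw [lintegral_add_left measurable_const, setLIntegral_const, one_mul]
      _ ≤ volume (Q i) + 2 ^ n * volume (Q i) := by gcongr; exact hQ2 i
      _ = _ := by rw [hD, add_mul, one_mul]
  have hui : ∀ i, IntegrableOn u (Q i) volume := fun i =>
    ⟨hum.restrict, (hQD i).trans_lt (ENNReal.mul_lt_top hDfin.lt_top (hQfin i).lt_top)⟩
  obtain ⟨a, ha⟩ : ∃ a : ι → ℂ, a = fun i => ⨍ y in Q i, u y := ⟨_, rfl⟩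
  have haD : ∀ i, ‖a i‖ₑ ≤ D := fun i => by
    rw [ha]; exact enorm_setAverage_le (hQfin i) (hQpos i) (hQD i)
  have hconst : ∀ i, MemLp ((Q i).indicator fun _ => a i) 2 volume := fun i =>
    memLp_indicator_const 2 (hQm i) _ (Or.inr (hQfin i))
  have hbL : ∀ i, MemLp ((Q i).indicator fun x => u x - a i) 2 volume := fun i => by
    rw [indicator_sub]
    exact ((Lp.memLp u).indicator (hQm i)).sub (hconst i)
  have hbi : ∀ i, Integrable ((Q i).indicator fun x => u x - a i) volume := fun i =>
    (integrable_indicator_iff (hQm i)).2 ((hui i).sub (integrableOn_const (hQfin i)))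
  set b : ι → Lp ℂ 2 (volume : Measure (Rn n)) := fun i => (hbL i).toLp with hb
  have hbcoe : ∀ i, b i =ᵐ[volume] (Q i).indicator fun x => u x - a i := fun i =>
    (hbL i).coeFn_toLp
  have hb0 : ∀ i, ∫ y, b i y = 0 := fun i => by
    have hc : IntegrableOn (fun _ => a i) (Q i) := integrableOn_const (hQfin i)
    rw [integral_congr_ae (hbcoe i), integral_indicator (hQm i), integral_sub (hui i) hc,
      setIntegral_const, ha, measure_smul_setAverage _ (hQfin i), sub_self]
  have hbD : ∀ i, ∫⁻ y, ‖b i y‖ₑ ≤ (D + D) * volume (Q i) := fun i => by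
    calc ∫⁻ y, ‖b i y‖ₑ = ∫⁻ y in Q i, ‖u y - a i‖ₑ := by
          rw [← lintegral_indicator (hQm i)]
          refine lintegral_congr_ae ?_
          filter_upwards [hbcoe i] with y hy
          rw [hy, enorm_indicator_eq_indicator_enorm]
      _ ≤ ∫⁻ y in Q i, (‖u y‖ₑ + D) := lintegral_mono fun y =>
          enorm_sub_le.trans (add_le_add_right (haD i) _)
      _ = (∫⁻ y in Q i, ‖u y‖ₑ) + D * volume (Q i) := by
          rw [lintegral_add_right _ measurable_const, setLIntegral_const]
      _ ≤ _ := by rw [add_mul D D]; exact add_le_add_left (hQD i) _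
  -- the remainder tends to zero
  have htail : Tendsto (fun F : Finset ι => (‖T‖ₑ ^ 2 * (1 + D ^ 2) + C₁) * M +
      ‖T‖ₑ ^ 2 * ∑' i : {i // i ∉ F}, ∫⁻ x in Q i, ‖u x‖ₑ ^ 2) atTop
      (𝓝 ((‖T‖ₑ ^ 2 * (1 + D ^ 2) + C₁) * M + ‖T‖ₑ ^ 2 * 0)) := by
    refine tendsto_const_nhds.add (ENNReal.Tendsto.const_mul
      (ENNReal.tendsto_tsum_compl_atTop_zero
        (f := fun i => ∫⁻ x in Q i, ‖u x‖ₑ ^ 2) ?_) (Or.inr hTfin))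
    rw [← lintegral_iUnion hQm hQd]
    refine ((setLIntegral_le_lintegral _ _).trans_lt ?_).ne
    rw [← enorm_sq_eq_lintegral]
    exact ENNReal.pow_lt_top enorm_lt_top
  rw [mul_zero, add_zero] at htail
  -- Only the finitely many cubes in `F` are corrected to mean zero. On the remaining cubes `u` is
  -- kept unchanged as a remainder `r`, to which the `L²` bound applies.
  refine ge_of_tendsto' htail fun F => ?_
  have hFm : MeasurableSet (U \ ⋃ i ∈ F, Q i) :=
    hUm.diff (Finset.measurableSet_biUnion F fun i _ => hQm i)
  have hgL : MemLp (fun x => Uᶜ.indicator u x + ∑ i ∈ F, (Q i).indicator (fun _ => a i) x)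
      2 volume :=
    ((Lp.memLp u).indicator hUm.compl).add (memLp_finsetSum F fun i _ => hconst i)
  have hrL : MemLp ((U \ ⋃ i ∈ F, Q i).indicator u) 2 volume := (Lp.memLp u).indicator hFm
  set g := hgL.toLp with hg
  set r := hrL.toLp with hr
  have hdec : u = g + ∑ i ∈ F, b i + r := by
    refine Lp.ext ?_
    filter_upwards [Lp.coeFn_add (g + ∑ i ∈ F, b i) r, Lp.coeFn_add g (∑ i ∈ F, b i),
      hgL.coeFn_toLp, hrL.coeFn_toLp, coeFn_finsetSum_Lp F b,
      (ae_ball_iff F.countable_toSet).2 fun i _ => hbcoe i] with x h1 h2 h3 h4 h5 h6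
    rw [h1, Pi.add_apply, h2, Pi.add_apply, h3, h4, h5, Finset.sum_congr rfl h6]
    by_cases hx : ∃ i ∈ F, x ∈ Q i
    · obtain ⟨i, hi, hxi⟩ := hx
      have hxU : x ∈ U := mem_iUnion.2 ⟨i, hxi⟩
      rw [sum_indicator_of_mem hQd F (fun i _ => a i) hxi hi,
        sum_indicator_of_mem hQd F (fun i x => u x - a i) hxi hi,
        indicator_of_notMem (notMem_compl_iff.2 hxU),
        indicator_of_notMem (fun h => h.2 (mem_iUnion₂.2 ⟨i, hi, hxi⟩))]
      ring
    · push Not at hx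
      rw [sum_indicator_of_notMem F (fun i _ => a i) hx,
        sum_indicator_of_notMem F (fun i x => u x - a i) hx]
      by_cases hxU : x ∈ U
      · rw [indicator_of_notMem (notMem_compl_iff.2 hxU), indicator_of_mem]
        · ring
        · refine ⟨hxU, fun h => ?_⟩
          obtain ⟨i, hi, hxi⟩ := mem_iUnion₂.1 h
          exact hx i hi hxi
      · rw [indicator_of_mem (show x ∈ Uᶜ from hxU), indicator_of_notMem (fun h => hxU h.1)]
        ring
  -- The height 3 is shared equally among the good part, the bad part and the remainder.
  have hTu : {x | 3 < ‖T u x‖ₑ} ≤ᵐ[volume] (({x | 1 < ‖T g x‖ₑ} ∪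
      {x | 1 < ‖T (∑ i ∈ F, b i) x‖ₑ}) ∪ {x | 1 < ‖T r x‖ₑ} : Set (Rn n)) := by
    have h0 : T u = T g + T (∑ i ∈ F, b i) + T r := by rw [← map_add, ← map_add, ← hdec]
    rw [h0]
    filter_upwards [Lp.coeFn_add (T g + T (∑ i ∈ F, b i)) (T r),
      Lp.coeFn_add (T g) (T (∑ i ∈ F, b i))] with x h1 h2 hx
    by_contra hnot
    have hx : 3 < ‖(T g + T (∑ i ∈ F, b i) + T r : Lp ℂ 2 (volume : Measure (Rn n))) x‖ₑ := hx
    have h3 : ¬ ((1 < ‖T g x‖ₑ ∨ 1 < ‖T (∑ i ∈ F, b i) x‖ₑ) ∨ 1 < ‖T r x‖ₑ) := hnot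
    push Not at h3
    refine hx.not_ge ?_
    rw [h1, Pi.add_apply, h2, Pi.add_apply]
    calc _ ≤ ‖T g x‖ₑ + ‖T (∑ i ∈ F, b i) x‖ₑ + ‖T r x‖ₑ :=
          (enorm_add_le _ _).trans (add_le_add_left (enorm_add_le _ _) _)
      _ ≤ 1 + 1 + 1 := add_le_add (add_le_add h3.1.1 h3.1.2) h3.2
      _ = 3 := by norm_num
  have hgood : ∫⁻ x, ‖g x‖ₑ ^ 2 ≤ (1 + D ^ 2) * M := by
    calc ∫⁻ x, ‖g x‖ₑ ^ 2 ≤ ∫⁻ x, (‖u x‖ₑ ^ p + U.indicator (fun _ => D ^ 2) x) := by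
          refine lintegral_mono_ae ?_
          filter_upwards [hgL.coeFn_toLp, hQ3] with x hx hx3
          rw [hx]
          by_cases hxU : x ∈ U
          · rw [indicator_of_notMem (notMem_compl_iff.2 hxU), zero_add, indicator_of_mem hxU]
            refine le_trans ?_ le_add_self
            gcongr
            by_cases hxF : ∃ i ∈ F, x ∈ Q i
            · obtain ⟨i, hi, hxi⟩ := hxF
              rw [sum_indicator_of_mem hQd F (fun i _ => a i) hxi hi]
              exact haD i
            · push Not at hxF
              rw [sum_indicator_of_notMem F (fun i _ => a i) hxF, enorm_zero]
              exact zero_le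
          · rw [indicator_of_mem (show x ∈ Uᶜ from hxU), sum_indicator_of_notMem F (fun i _ => a i)
              (fun i _ hxi => hxU (mem_iUnion.2 ⟨i, hxi⟩)), add_zero]
            refine le_trans ?_ le_self_add
            have h1 : ‖u x‖ ≤ 1 := by
              by_contra hlt
              exact (Real.one_lt_rpow (not_le.1 hlt) hp0).not_ge (hx3 hxU)
            have h2 : ‖u x‖ₑ ≤ 1 := by
              rw [← ofReal_norm]
              exact ENNReal.ofReal_le_one.2 h1
            -- Here `p ≤ 2` enters: off the cubes `|u| ≤ 1`, so `|u|² ≤ |u|^p`.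
            rw [← ENNReal.rpow_two]
            exact ENNReal.rpow_le_rpow_of_exponent_ge h2 hp2
      _ = M + D ^ 2 * volume U := by
          rw [lintegral_add_right _ (measurable_const.indicator hUm), lintegral_indicator hUm,
            setLIntegral_const]
      _ ≤ M + D ^ 2 * M := by
          gcongr
          exact (measure_iUnion_le Q).trans hvolU
      _ = _ := by rw [add_mul, one_mul]
  have hrem : ∫⁻ x, ‖r x‖ₑ ^ 2 ≤ ∑' i : {i // i ∉ F}, ∫⁻ x in Q i, ‖u x‖ₑ ^ 2 := by
    calc ∫⁻ x, ‖r x‖ₑ ^ 2 = ∫⁻ x in U \ ⋃ i ∈ F, Q i, ‖u x‖ₑ ^ 2 := by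
          rw [← lintegral_indicator hFm]
          refine lintegral_congr_ae ?_
          filter_upwards [hrL.coeFn_toLp] with x hx
          rw [hx]
          by_cases hxF : x ∈ U \ ⋃ i ∈ F, Q i
          · rw [indicator_of_mem hxF, indicator_of_mem hxF]
          · rw [indicator_of_notMem hxF, indicator_of_notMem hxF, enorm_zero,
              zero_pow two_ne_zero]
      _ ≤ ∫⁻ x in ⋃ i : {i // i ∉ F}, Q i, ‖u x‖ₑ ^ 2 := by
          refine lintegral_mono_set fun x hx => ?_
          obtain ⟨i, hi⟩ := mem_iUnion.1 hx.1
          exact mem_iUnion.2 ⟨⟨i, fun hiF => hx.2 (mem_iUnion₂.2 ⟨i, hiF, hi⟩)⟩, hi⟩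
      _ ≤ _ := lintegral_iUnion_le _ _
  have hbad := hT.volume_one_lt_enorm_sum_le hn h F Q c s b (D + D) hs hQs hsQ
    (fun i => by
      filter_upwards [hbcoe i] with y hy hyQ
      rw [hy, indicator_of_notMem hyQ])
    (fun i => (hbi i).congr (hbcoe i).symm) hb0 hbD
  calc volume {x | 3 < ‖T u x‖ₑ}
      ≤ volume {x | 1 < ‖T g x‖ₑ} + volume {x | 1 < ‖T (∑ i ∈ F, b i) x‖ₑ} +
          volume {x | 1 < ‖T r x‖ₑ} :=
        (measure_mono_ae hTu).trans ((measure_union_le _ _).trans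
          (add_le_add_left (measure_union_le _ _) _))
    _ ≤ ‖T‖ₑ ^ 2 * ((1 + D ^ 2) * M) + C₁ * M +
          ‖T‖ₑ ^ 2 * ∑' i : {i // i ∉ F}, ∫⁻ x in Q i, ‖u x‖ₑ ^ 2 := by
        refine add_le_add (add_le_add ?_ ?_) ?_
        · exact (volume_one_lt_enorm_map_le T g).trans (by gcongr)
        · exact hbad.trans (by gcongr; exact (ENNReal.sum_le_tsum F).trans hvolU)
        · exact (volume_one_lt_enorm_map_le T r).trans (by gcongr)
    _ = _ := by ring

end WeakType

/-! ### Weak type inequality at all heights, and for `p > 2` by duality -/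

/-- `T` is of weak type `(p, p)` on `L² ∩ L^p`. -/
def HasWeakType {n : ℕ}
    (T : Lp ℂ 2 (volume : Measure (Rn n)) →L[ℂ] Lp ℂ 2 (volume : Measure (Rn n))) (p : ℝ) : Prop :=
  ∃ C : ℝ≥0∞, C ≠ ∞ ∧ ∀ t : ℝ, 0 < t → ∀ u : Lp ℂ 2 (volume : Measure (Rn n)),
    ∫⁻ x, ‖u x‖ₑ ^ p ≠ ∞ →
      volume {x | t < ‖T u x‖} ≤ C * ENNReal.ofReal (t ^ (-p)) * ∫⁻ x, ‖u x‖ₑ ^ p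

section HasWeakType

variable {n : ℕ} {ρ : Rn n → Rn n → ℝ} {K : Rn n → Rn n → ℂ} {V A δ : ℝ}
  {T : Lp ℂ 2 (volume : Measure (Rn n)) →L[ℂ] Lp ℂ 2 (volume : Measure (Rn n))}

theorem ofReal_lt_enorm_iff {t : ℝ} (ht : 0 ≤ t) (z : ℂ) : ENNReal.ofReal t < ‖z‖ₑ ↔ t < ‖z‖ := by
  rw [← ofReal_norm, ENNReal.ofReal_lt_ofReal_iff_of_nonneg ht]

/-- By homogeneity it is enough to prove a weak type inequality at one height. -/
theorem hasWeakType_of_height {p t₀ : ℝ} (hp : 0 ≤ p) (ht₀ : 0 < t₀)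
    (h : ∃ C : ℝ≥0∞, C ≠ ∞ ∧ ∀ u : Lp ℂ 2 (volume : Measure (Rn n)), ∫⁻ x, ‖u x‖ₑ ^ p ≠ ∞ →
      volume {x | t₀ < ‖T u x‖} ≤ C * ∫⁻ x, ‖u x‖ₑ ^ p) : HasWeakType T p := by
  obtain ⟨C, hC, h⟩ := h
  refine ⟨C * ENNReal.ofReal (t₀ ^ p), by finiteness, fun t ht u hu => ?_⟩
  have hc : 0 < t₀ / t := by positivity
  set c : ℂ := ((t₀ / t : ℝ) : ℂ) with hcdef
  have hcn : ‖c‖ = t₀ / t := by rw [hcdef, Complex.norm_real, Real.norm_of_nonneg hc.le]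
  have hscale : ∫⁻ x, ‖(c • u : Lp ℂ 2 (volume : Measure (Rn n))) x‖ₑ ^ p =
      ENNReal.ofReal ((t₀ / t) ^ p) * ∫⁻ x, ‖u x‖ₑ ^ p := by
    rw [← lintegral_const_mul' _ _ ENNReal.ofReal_ne_top]
    refine lintegral_congr_ae ?_
    filter_upwards [Lp.coeFn_smul c u] with x hx
    rw [hx, Pi.smul_apply, enorm_smul, ENNReal.mul_rpow_of_nonneg _ _ hp, ← ofReal_norm, hcn,
      ENNReal.ofReal_rpow_of_pos hc]
  have h1 := h (c • u) (by rw [hscale]; exact ENNReal.mul_ne_top ENNReal.ofReal_ne_top hu)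
  rw [hscale] at h1
  calc volume {x | t < ‖T u x‖} ≤ volume {x | t₀ < ‖T (c • u) x‖} := by
        refine measure_mono_ae ?_
        rw [map_smul]
        filter_upwards [Lp.coeFn_smul c (T u)] with x hx hxt
        have hxt : t < ‖T u x‖ := hxt
        change t₀ < ‖(c • T u : Lp ℂ 2 (volume : Measure (Rn n))) x‖
        rw [hx, Pi.smul_apply, norm_smul, hcn, div_mul_eq_mul_div, lt_div_iff₀ ht]
        exact mul_lt_mul_of_pos_left hxt ht₀
    _ ≤ _ := h1
    _ = _ := by
        rw [Real.div_rpow ht₀.le ht.le, div_eq_mul_inv, ← Real.rpow_neg ht.le,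
          ENNReal.ofReal_mul (by positivity)]
        ring

theorem Represents.hasWeakType_of_le_two (hn : 1 ≤ n) (h : SingularKernel ρ K V A δ)
    (hT : Represents T ρ K) {p : ℝ} (hp1 : 1 ≤ p) (hp2 : p ≤ 2) : HasWeakType T p := by
  refine hasWeakType_of_height (t₀ := 3) (by linarith) (by norm_num) ?_
  obtain ⟨C, hC, h1⟩ := hT.exists_weakType_of_le_two hn h hp1 hp2
  refine ⟨C, hC, fun u hu => ?_⟩
  have h3 : ENNReal.ofReal 3 = 3 := by norm_num
  simp_rw [← ofReal_lt_enorm_iff (show (0 : ℝ) ≤ 3 by norm_num), h3]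
  exact h1 u hu

/-- Restricted strong type `(q, q)` by interpolation between weak type `(1, 1)` and `L²`. -/
theorem HasWeakType.exists_lintegral_rpow_le (hT : HasWeakType T 1) {q : ℝ} (hq1 : 1 < q)
    (hq2 : q < 2) :
    ∃ B : ℝ≥0∞, B ≠ ∞ ∧ ∀ (E : Set (Rn n)) (v : Lp ℂ 2 (volume : Measure (Rn n))),
      MeasurableSet E → volume E ≠ ∞ → (∀ᵐ x, ‖v x‖ₑ ≤ E.indicator 1 x) →
      ∫⁻ x, ‖T v x‖ₑ ^ q ≤ B * volume E := by
  obtain ⟨C, hC, h⟩ := hT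
  have hTfin : ‖T‖ₑ ^ 2 ≠ ∞ := ENNReal.pow_ne_top enorm_ne_top
  refine ⟨C * ENNReal.ofReal (q / (q - 1)) + ‖T‖ₑ ^ 2, by finiteness, fun E v hE hEfin hv => ?_⟩
  have hv1 : ∫⁻ x, ‖v x‖ₑ ^ (1 : ℝ) ≤ volume E := by
    rw [← lintegral_indicator_one hE]
    refine lintegral_mono_ae ?_
    filter_upwards [hv] with x hx
    rwa [ENNReal.rpow_one]
  have hv2 : ∫⁻ x, ‖v x‖ₑ ^ 2 ≤ volume E := by
    rw [← lintegral_indicator_one hE]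
    refine lintegral_mono_ae ?_
    filter_upwards [hv] with x hx
    refine (pow_le_pow_left₀ zero_le hx 2).trans ?_
    by_cases hxE : x ∈ E
    · rw [indicator_of_mem hxE, Pi.one_apply, one_pow]
    · rw [indicator_of_notMem hxE, zero_pow two_ne_zero]
  have hsmall : ∫⁻ x, ENNReal.ofReal (min ‖T v x‖ 1 ^ q) ≤
      C * ENNReal.ofReal (q / (q - 1)) * volume E := by
    have h1 := lintegral_rpow_le_of_meas_lt_le (μ := volume) (f := fun x => min ‖T v x‖ 1)
      (L := 1) (d := 1) (β := q) (C := C * volume E)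
      ((Lp.aestronglyMeasurable (T v)).norm.aemeasurable.min aemeasurable_const)
      (fun x => le_min (norm_nonneg _) zero_le_one) one_pos zero_le_one hq1
      (fun x => min_le_right _ _) (fun t ht => by
        refine (measure_mono fun x hx => ?_).trans ((h t ht v
          (hv1.trans_lt hEfin.lt_top).ne).trans ?_)
        · exact lt_of_lt_of_le (show t < min ‖T v x‖ 1 from hx) (min_le_left _ _)
        · rw [mul_right_comm]
          gcongr)
    rw [Real.one_rpow, mul_one] at h1
    exact h1.trans_eq (mul_right_comm _ _ _)
  -- Values of `|T v|` below 1 are handled by weak type `(1, 1)`, as `q > 1`; above 1, `q < 2` gives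
  -- `|T v|^q ≤ |T v|²`.
  calc ∫⁻ x, ‖T v x‖ₑ ^ q
      ≤ ∫⁻ x, (ENNReal.ofReal (min ‖T v x‖ 1 ^ q) + ‖T v x‖ₑ ^ 2) := by
        refine lintegral_mono fun x => ?_
        rcases le_total ‖T v x‖ 1 with hx | hx
        · rw [min_eq_left hx, ← ENNReal.ofReal_rpow_of_nonneg (norm_nonneg _) (by linarith),
            ofReal_norm]
          exact le_self_add
        · refine le_trans ?_ le_add_self
          rw [← ENNReal.rpow_two]
          refine ENNReal.rpow_le_rpow_of_exponent_le ?_ hq2.le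
          rw [← ofReal_norm]
          exact ENNReal.one_le_ofReal.2 hx
    _ = (∫⁻ x, ENNReal.ofReal (min ‖T v x‖ 1 ^ q)) + ∫⁻ x, ‖T v x‖ₑ ^ 2 :=
        lintegral_add_right' _ ((Lp.aestronglyMeasurable (T v)).enorm.pow_const 2)
    _ ≤ C * ENNReal.ofReal (q / (q - 1)) * volume E + ‖T‖ₑ ^ 2 * volume E := by
        refine add_le_add hsmall ((lintegral_enorm_sq_map_le T v).trans ?_)
        gcongr
    _ = _ := (add_mul _ _ _).symm

theorem enorm_inner_le_lintegral (v u : Lp ℂ 2 (volume : Measure (Rn n))) :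
    ‖inner ℂ v u‖ₑ ≤ ∫⁻ x, ‖v x‖ₑ * ‖u x‖ₑ := by
  rw [L2.inner_def]
  refine (enorm_integral_le_lintegral_enorm _).trans (lintegral_mono fun x => ?_)
  rw [← ofReal_norm, ← ofReal_norm, ← ofReal_norm, ← ENNReal.ofReal_mul (norm_nonneg _)]
  exact ENNReal.ofReal_le_ofReal (norm_inner_le_norm _ _)

/-- Testing against the phase of `T u` on the set where `T u` is large. -/
theorem volume_le_lintegral_adjoint (u : Lp ℂ 2 (volume : Measure (Rn n))) :
    ∃ v : Lp ℂ 2 (volume : Measure (Rn n)),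
      (∀ᵐ x, ‖v x‖ₑ ≤ {x | 1 < ‖T u x‖}.indicator 1 x) ∧
      volume {x | 1 < ‖T u x‖} ≤ ∫⁻ x, ‖ContinuousLinearMap.adjoint T v x‖ₑ * ‖u x‖ₑ := by
  have hTm : Measurable (T u : Rn n → ℂ) := (Lp.stronglyMeasurable (T u)).measurable
  have hE : MeasurableSet {x | 1 < ‖T u x‖} := measurableSet_lt measurable_const hTm.norm
  have hEfin : volume {x | 1 < ‖T u x‖} ≠ ∞ := by
    simp_rw [← ofReal_lt_enorm_iff zero_le_one, ENNReal.ofReal_one]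
    refine ((volume_one_lt_enorm_map_le T u).trans_lt ?_).ne
    rw [← enorm_sq_eq_lintegral, ← mul_pow]
    exact ENNReal.pow_lt_top (ENNReal.mul_lt_top enorm_lt_top enorm_lt_top)
  generalize hEdef : {x | 1 < ‖T u x‖} = E at hE hEfin ⊢
  have hEmem : ∀ x ∈ E, 1 < ‖T u x‖ := fun x hx => by rw [← hEdef] at hx; exact hx
  have hphase : ∀ x, ‖E.indicator (fun x => T u x / (‖T u x‖ : ℂ)) x‖ ≤
      ‖E.indicator (fun _ => (1 : ℂ)) x‖ := fun x => by
    by_cases hx : x ∈ E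
    · rw [indicator_of_mem hx, indicator_of_mem hx, norm_div, Complex.norm_real, norm_norm,
        norm_one]
      exact div_self_le_one _
    · rw [indicator_of_notMem hx, indicator_of_notMem hx]
  have hvL : MemLp (E.indicator fun x => T u x / (‖T u x‖ : ℂ)) 2 volume :=
    (memLp_indicator_const 2 hE (1 : ℂ) (Or.inr hEfin)).mono
      (((hTm.div (Complex.measurable_ofReal.comp hTm.norm)).indicator hE).aestronglyMeasurable)
      (ae_of_all _ hphase)
  refine ⟨hvL.toLp, ?_, ?_⟩
  · filter_upwards [hvL.coeFn_toLp] with x hx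
    rw [hx]
    refine (enorm_le_iff_norm_le.2 (hphase x)).trans_eq ?_
    by_cases hx : x ∈ E
    · rw [indicator_of_mem hx, indicator_of_mem hx, enorm_one, Pi.one_apply]
    · rw [indicator_of_notMem hx, indicator_of_notMem hx, enorm_zero]
  · have hfinE := isFiniteMeasure_restrict.2 hEfin
    have hTi : IntegrableOn (fun x => ‖T u x‖) E :=
      (((Lp.memLp (T u)).restrict E).integrable one_le_two).norm
    -- Pairing with the phase gives `∫_E |T u|`, which is at least `volume E` because `|T u| > 1` on
    -- `E`.
    have h1 : inner ℂ hvL.toLp (T u) = ((∫ x in E, ‖T u x‖ : ℝ) : ℂ) := by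
      rw [L2.inner_def, ← integral_indicator hE]
      refine Eq.trans ?_ integral_ofReal
      refine integral_congr_ae ?_
      filter_upwards [hvL.coeFn_toLp] with x hx
      rw [hx]
      by_cases hxE : x ∈ E
      · rw [indicator_of_mem hxE, indicator_of_mem hxE, RCLike.inner_apply, map_div₀,
          Complex.conj_ofReal, ← mul_div_assoc, RCLike.mul_conj]
        have : (‖T u x‖ : ℂ) ≠ 0 := by
          exact_mod_cast (zero_lt_one.trans (hEmem x hxE)).ne'
        simp only [Complex.coe_algebraMap]
        field_simp
      · rw [indicator_of_notMem hxE, indicator_of_notMem hxE, inner_zero_left]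
        simp
    have h2 : volume.real E ≤ ∫ x in E, ‖T u x‖ := by
      have := setIntegral_mono_on (integrableOn_const hEfin) hTi hE
        (f := fun _ => (1 : ℝ)) fun x hx => (hEmem x hx).le
      simpa using this
    have h3 : inner ℂ (ContinuousLinearMap.adjoint T hvL.toLp) u =
        ((∫ x in E, ‖T u x‖ : ℝ) : ℂ) := by
      rw [← h1]
      exact ContinuousLinearMap.adjoint_inner_left T u _
    calc volume E = ENNReal.ofReal (volume.real E) := by
          rw [Measure.real, ENNReal.ofReal_toReal hEfin]
      _ ≤ ‖inner ℂ (ContinuousLinearMap.adjoint T hvL.toLp) u‖ₑ := by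
          rw [h3, ← ofReal_norm, Complex.norm_real]
          exact ENNReal.ofReal_le_ofReal (h2.trans (Real.le_norm_self _))
      _ ≤ _ := enorm_inner_le_lintegral _ _

/-- Young's inequality with absorption. -/
theorem le_mul_lintegral_rpow_of_le_lintegral_mul {α : Type*} [MeasurableSpace α] {μ : Measure α}
    {p q : ℝ} (hpq : p.HolderConjugate q) {f g : α → ℝ≥0∞} (hf : AEMeasurable f μ)
    {m B : ℝ≥0∞} (hm : m ≠ ∞) (hB : B ≠ ∞) (h1 : m ≤ ∫⁻ x, f x * g x ∂μ)
    (h2 : ∫⁻ x, f x ^ q ∂μ ≤ B * m) :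
    m ≤ 2 * (2 * (B + 1)) ^ p * ∫⁻ x, g x ^ p ∂μ := by
  have hp1 : 1 < p := hpq.lt
  have hq1 : 1 < q := hpq.symm.lt
  -- With this `t` one has `t * B ≤ 1 / 2`, so the first Young term is at most `m / 2` and can be
  -- absorbed, `m` being finite. Adding 1 to `B` also ensures `t ≤ 1`, whence `t ^ q ≤ t`.
  obtain ⟨t, ht⟩ : ∃ t : ℝ≥0∞, t = (2 * (B + 1))⁻¹ := ⟨_, rfl⟩
  have hti : t⁻¹ = 2 * (B + 1) := by rw [ht, inv_inv]
  have ht0 : t ≠ 0 := ht ▸ ENNReal.inv_ne_zero.2 (by finiteness)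
  have htfin : t ≠ ∞ := ht ▸ ENNReal.inv_ne_top.2 (by simp)
  have ht1 : t ≤ 1 := by
    rw [ht, ENNReal.inv_le_one]
    calc (1 : ℝ≥0∞) ≤ 2 * 1 := by norm_num
      _ ≤ 2 * (B + 1) := by gcongr; exact le_add_self
  have htB : t * B ≤ 1 / 2 := by
    rw [ht, ENNReal.mul_inv (by simp) (by simp), mul_assoc, one_div]
    refine mul_le_of_le_one_right' ?_
    rw [mul_comm, ← div_eq_mul_inv]
    exact ENNReal.div_le_of_le_mul (by rw [one_mul]; exact le_self_add)
  have hyoung : ∀ x, f x * g x ≤ t * f x ^ q + t⁻¹ ^ p * g x ^ p := fun x => by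
    calc f x * g x = (t * f x) * (t⁻¹ * g x) := by
          rw [mul_mul_mul_comm, ENNReal.mul_inv_cancel ht0 htfin, one_mul]
      _ ≤ (t * f x) ^ q / ENNReal.ofReal q + (t⁻¹ * g x) ^ p / ENNReal.ofReal p :=
          ENNReal.young_inequality _ _ hpq.symm
      _ ≤ (t * f x) ^ q + (t⁻¹ * g x) ^ p := add_le_add
          (ENNReal.div_le_of_le_mul (le_mul_of_one_le_right' (ENNReal.one_le_ofReal.2 hq1.le)))
          (ENNReal.div_le_of_le_mul (le_mul_of_one_le_right' (ENNReal.one_le_ofReal.2 hp1.le)))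
      _ ≤ _ := by
          rw [ENNReal.mul_rpow_of_nonneg _ _ (by linarith),
            ENNReal.mul_rpow_of_nonneg _ _ (by linarith)]
          gcongr
          exact ENNReal.rpow_le_self_of_le_one ht1 hq1.le
  have htp : t⁻¹ ^ p ≠ ∞ := by rw [hti]; finiteness
  have hmain : m ≤ m / 2 + t⁻¹ ^ p * ∫⁻ x, g x ^ p ∂μ := by
    calc m ≤ ∫⁻ x, (t * f x ^ q + t⁻¹ ^ p * g x ^ p) ∂μ := h1.trans (lintegral_mono hyoung)
      _ = t * (∫⁻ x, f x ^ q ∂μ) + t⁻¹ ^ p * ∫⁻ x, g x ^ p ∂μ := by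
          rw [lintegral_add_left' ((hf.pow_const q).const_mul t),
            lintegral_const_mul' _ _ htfin, lintegral_const_mul' _ _ htp]
      _ ≤ _ := by
          gcongr
          calc t * ∫⁻ x, f x ^ q ∂μ ≤ t * (B * m) := by gcongr
            _ = t * B * m := (mul_assoc _ _ _).symm
            _ ≤ 1 / 2 * m := by gcongr
            _ = _ := by rw [one_div, mul_comm, div_eq_mul_inv]
  have hhalf : m / 2 ≤ t⁻¹ ^ p * ∫⁻ x, g x ^ p ∂μ := by
    have h2 : m / 2 + m / 2 ≤ m / 2 + t⁻¹ ^ p * ∫⁻ x, g x ^ p ∂μ := by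
      rwa [ENNReal.add_halves]
    exact (ENNReal.add_le_add_iff_left (ENNReal.div_ne_top hm two_ne_zero)).1 h2
  calc m = 2 * (m / 2) := (ENNReal.mul_div_cancel two_ne_zero (by simp)).symm
    _ ≤ 2 * (t⁻¹ ^ p * ∫⁻ x, g x ^ p ∂μ) := by gcongr
    _ = _ := by rw [hti, mul_assoc]

/-- Weak type `(p, p)` for `p > 2`, from weak type `(1, 1)` of the adjoint. -/
theorem HasWeakType.of_adjoint (hT : HasWeakType (ContinuousLinearMap.adjoint T) 1) {p : ℝ}
    (hp : 2 < p) : HasWeakType T p := by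
  refine hasWeakType_of_height (t₀ := 1) (by linarith) one_pos ?_
  have hpq : p.HolderConjugate p.conjExponent := Real.HolderConjugate.conjExponent (by linarith)
  have hq2 : p.conjExponent < 2 := by
    rw [Real.conjExponent, div_lt_iff₀ (by linarith)]
    linarith
  obtain ⟨B, hB, hBE⟩ := hT.exists_lintegral_rpow_le hpq.symm.lt hq2
  refine ⟨2 * (2 * (B + 1)) ^ p, by finiteness, fun u hu => ?_⟩
  obtain ⟨v, hv, hvE⟩ := volume_le_lintegral_adjoint (T := T) u
  have hE : MeasurableSet {x | 1 < ‖T u x‖} :=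
    measurableSet_lt measurable_const (Lp.stronglyMeasurable (T u)).measurable.norm
  have hEfin : volume {x | 1 < ‖T u x‖} ≠ ∞ := by
    simp_rw [← ofReal_lt_enorm_iff zero_le_one, ENNReal.ofReal_one]
    refine ((volume_one_lt_enorm_map_le T u).trans_lt ?_).ne
    rw [← enorm_sq_eq_lintegral, ← mul_pow]
    exact ENNReal.pow_lt_top (ENNReal.mul_lt_top enorm_lt_top enorm_lt_top)
  -- Here `m` is the volume of `{|T u| > 1}`, `f = |T* v|` and `g = |u|`; the restricted bound for
  -- `T*` controls the power integral of `f` by `m` itself.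
  exact le_mul_lintegral_rpow_of_le_lintegral_mul hpq
    (Lp.aestronglyMeasurable (ContinuousLinearMap.adjoint T v)).enorm hEfin hB hvE
    (hBE _ v hE hEfin hv)

theorem Represents.hasWeakType (hn : 1 ≤ n) (h : SingularKernel ρ K V A δ)
    (hT : Represents T ρ K) {p : ℝ} (hp : 1 ≤ p) : HasWeakType T p := by
  rcases le_or_gt p 2 with hp2 | hp2
  · exact hT.hasWeakType_of_le_two hn h hp hp2
  · exact HasWeakType.of_adjoint ((hT.adjoint hn h).hasWeakType_of_le_two hn h.adjoint le_rfl
      one_le_two) hp2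

end HasWeakType

/-! ### Extension to `L^p` and the integral formula -/

/-- Fatou's lemma for sets. -/
theorem measure_le_of_ae_eventually_mem {α : Type*} [MeasurableSpace α] {μ : Measure α}
    {S : Set α} {s : ℕ → Set α} (h : ∀ᵐ x ∂μ, x ∈ S → ∀ᶠ j in atTop, x ∈ s j) {c : ℕ → ℝ≥0∞}
    {L : ℝ≥0∞} (hs : ∀ j, μ (s j) ≤ c j) (hc : Tendsto c atTop (𝓝 L)) : μ S ≤ L := by
  have hmono : Monotone fun N => ⋂ j ∈ Ici N, s j := fun N N' hN =>
    biInter_mono (Ici_subset_Ici.2 hN) fun _ _ => le_rfl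
  have h1 : S ≤ᵐ[μ] (⋃ N, ⋂ j ∈ Ici N, s j : Set α) := by
    filter_upwards [h] with x hx hxS
    obtain ⟨N, hN⟩ := eventually_atTop.1 (hx hxS)
    exact mem_iUnion.2 ⟨N, mem_iInter₂.2 hN⟩
  refine (measure_mono_ae h1).trans ?_
  rw [hmono.measure_iUnion]
  refine iSup_le fun N => ge_of_tendsto hc ?_
  filter_upwards [eventually_ge_atTop N] with j hj
  exact (measure_mono (biInter_subset_of_mem hj)).trans (hs j)

/-- Truncations of an `L^p` function. -/
theorem exists_truncation {n : ℕ} {p : ℝ≥0∞} (hp1 : 1 ≤ p) (hp : p ≠ ∞) {f : Rn n → ℂ}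
    (hf : MemLp f p volume) :
    ∃ B : ℕ → Set (Rn n), (∀ k, MeasurableSet (B k)) ∧ (∀ x, ∀ᶠ k in atTop, x ∈ B k) ∧
      (∀ k, MemLp ((B k).indicator f) 2 volume) ∧
      Tendsto (fun k => eLpNorm ((B k).indicator f - f) p volume) atTop (𝓝 0) := by
  set f₀ := hf.1.mk f with hf₀
  have hm : Measurable f₀ := hf.1.stronglyMeasurable_mk.measurable
  have hB : ∀ k : ℕ, MeasurableSet ({x | ‖f₀ x‖ ≤ k} ∩ Metric.closedBall 0 k) := fun k =>
    (measurableSet_le hm.norm measurable_const).inter measurableSet_closedBall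
  have hev : ∀ x, ∀ᶠ k : ℕ in atTop, x ∈ {x | ‖f₀ x‖ ≤ k} ∩ Metric.closedBall 0 k := fun x => by
    filter_upwards [eventually_ge_atTop ⌈‖f₀ x‖⌉₊, eventually_ge_atTop ⌈‖x‖⌉₊] with k h1 h2
    exact ⟨Nat.ceil_le.1 h1, mem_closedBall_zero_iff.2 (Nat.ceil_le.1 h2)⟩
  refine ⟨fun k => {x | ‖f₀ x‖ ≤ k} ∩ Metric.closedBall 0 k, hB, hev, fun k => ?_, ?_⟩
  · have hfin : volume ({x | ‖f₀ x‖ ≤ k} ∩ Metric.closedBall 0 k) ≠ ∞ :=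
      ((measure_mono inter_subset_right).trans_lt measure_closedBall_lt_top).ne
    refine (memLp_indicator_const 2 (hB k) (k : ℂ) (Or.inr hfin)).mono
      (hf.1.indicator (hB k)) ?_
    filter_upwards [hf.1.ae_eq_mk] with x hx
    by_cases hxB : x ∈ {x | ‖f₀ x‖ ≤ k} ∩ Metric.closedBall 0 (k : ℝ)
    · rw [indicator_of_mem hxB, indicator_of_mem hxB, hx, RCLike.norm_natCast]
      exact hxB.1
    · rw [indicator_of_notMem hxB, indicator_of_notMem hxB]
  · have hp0 : 0 < p.toReal := ENNReal.toReal_pos (zero_lt_one.trans_le hp1).ne' hp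
    have hfint : ∫⁻ x, ‖f x‖ₑ ^ p.toReal ≠ ∞ :=
      ((eLpNorm_lt_top_iff_lintegral_rpow_enorm_lt_top (zero_lt_one.trans_le hp1).ne' hp).1
        hf.2).ne
    have hlim := tendsto_lintegral_of_dominated_convergence' (μ := volume)
      (F := fun (k : ℕ) x => ‖(({x | ‖f₀ x‖ ≤ k} ∩ Metric.closedBall 0 (k : ℝ)).indicator f - f)
        x‖ₑ ^ p.toReal) (f := fun _ => 0) (fun x => ‖f x‖ₑ ^ p.toReal)
      (fun k => ((hf.1.indicator (hB k)).sub hf.1).enorm.pow_const _)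
      (fun k => ae_of_all _ fun x => by
        refine ENNReal.rpow_le_rpow ?_ hp0.le
        by_cases hxB : x ∈ {x | ‖f₀ x‖ ≤ k} ∩ Metric.closedBall 0 (k : ℝ)
        · rw [Pi.sub_apply, indicator_of_mem hxB, sub_self, enorm_zero]; exact zero_le
        · rw [Pi.sub_apply, indicator_of_notMem hxB, zero_sub, enorm_neg])
      hfint (ae_of_all _ fun x => by
        refine tendsto_const_nhds.congr' ?_
        filter_upwards [hev x] with k hk
        rw [Pi.sub_apply, indicator_of_mem hk, sub_self, enorm_zero, ENNReal.zero_rpow_of_pos hp0])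
    rw [lintegral_zero] at hlim
    simp_rw [eLpNorm_eq_lintegral_rpow_enorm_toReal (zero_lt_one.trans_le hp1).ne' hp]
    have := (ENNReal.continuous_rpow_const (y := 1 / p.toReal)).tendsto 0 |>.comp hlim
    rwa [ENNReal.zero_rpow_of_pos (by positivity)] at this

/-- A function vanishes almost everywhere off its essential support. -/
theorem ae_eq_zero_of_notMem_essSupport {n : ℕ} (f : Rn n → ℂ) :
    ∀ᵐ x, x ∉ essSupport f → f x = 0 := by
  have h1 : (volume.restrict (Function.support f)) (essSupport f)ᶜ = 0 :=
    Measure.measure_compl_support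
  have hcl : IsClosed (essSupport f) := Measure.isClosed_support
  rw [Measure.restrict_apply hcl.measurableSet.compl] at h1
  filter_upwards [compl_mem_ae_iff.2 h1] with x hx hxS
  by_contra hne
  exact hx ⟨hxS, hne⟩

section Extension

variable {n : ℕ} {T : Lp ℂ 2 (volume : Measure (Rn n)) →L[ℂ] Lp ℂ 2 (volume : Measure (Rn n))}

/-- A Cauchy estimate in measure. The comparison passes through `f` only inside the `L^p` norm, as
`f` need not be in `L²`. -/
theorem HasWeakType.exists_volume_norm_sub_le {p : ℝ≥0∞} (hp1 : 1 ≤ p) (hp : p ≠ ∞)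
    (hT : HasWeakType T p.toReal) {f : Rn n → ℂ} (hf : MemLp f p volume) :
    ∃ C : ℝ → ℝ≥0∞, (∀ t, C t ≠ ∞) ∧ ∀ t, 0 < t → ∀ u v : Lp ℂ 2 (volume : Measure (Rn n)),
      MemLp u p volume → MemLp v p volume →
      volume {x | t < ‖T u x - T v x‖} ≤ C t * (eLpNorm ((u : Rn n → ℂ) - f) p volume +
        eLpNorm ((v : Rn n → ℂ) - f) p volume) ^ p.toReal := by
  obtain ⟨C, hC, h⟩ := hT
  have hp0 : p ≠ 0 := (zero_lt_one.trans_le hp1).ne'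
  have hp0' : 0 < p.toReal := ENNReal.toReal_pos hp0 hp
  refine ⟨fun t => C * ENNReal.ofReal (t ^ (-p.toReal)), fun t => by finiteness,
    fun t ht u v hu hv => ?_⟩
  have hnorm : ∀ w : Rn n → ℂ, ∫⁻ x, ‖w x‖ₑ ^ p.toReal = eLpNorm w p volume ^ p.toReal := by
    intro w
    rw [eLpNorm_eq_lintegral_rpow_enorm_toReal hp0 hp, ← ENNReal.rpow_mul,
      one_div_mul_cancel hp0'.ne', ENNReal.rpow_one]
  have hcoe := Lp.coeFn_sub u v
  have hfin : ∫⁻ x, ‖(u - v : Lp ℂ 2 (volume : Measure (Rn n))) x‖ₑ ^ p.toReal ≠ ∞ := by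
    rw [hnorm, eLpNorm_congr_ae hcoe]
    exact ENNReal.rpow_ne_top_of_nonneg hp0'.le (hu.sub hv).2.ne
  have h1 := h t ht (u - v) hfin
  rw [hnorm, eLpNorm_congr_ae hcoe, map_sub] at h1
  calc volume {x | t < ‖T u x - T v x‖}
      ≤ volume {x | t < ‖(T u - T v : Lp ℂ 2 (volume : Measure (Rn n))) x‖} := by
        refine measure_mono_ae ?_
        filter_upwards [Lp.coeFn_sub (T u) (T v)] with x hx hxt
        change t < ‖(T u - T v : Lp ℂ 2 (volume : Measure (Rn n))) x‖
        rw [hx]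
        exact hxt
    _ ≤ _ := h1
    _ ≤ _ := by
        gcongr
        have h2 : (u : Rn n → ℂ) - v = (u - f) - (v - f) := by ring
        rw [h2]
        exact eLpNorm_sub_le (hu.1.sub hf.1) (hv.1.sub hf.1) hp1

/-- The extension of an operator of weak type `(p, p)`: the images of all sequences in `L² ∩ L^p`
that converge to `f` in `L^p` converge in measure to the same function. -/
theorem HasWeakType.exists_limit {p : ℝ≥0∞} (hp1 : 1 ≤ p) (hp : p ≠ ∞)
    (hT : HasWeakType T p.toReal) {f : Rn n → ℂ} (hf : MemLp f p volume) :
    ∃ g : Rn n → ℂ, StronglyMeasurable g ∧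
      ∀ v : ℕ → Lp ℂ 2 (volume : Measure (Rn n)), (∀ k, MemLp (v k : Rn n → ℂ) p volume) →
        Tendsto (fun k => eLpNorm ((v k : Rn n → ℂ) - f) p volume) atTop (𝓝 0) →
        TendstoInMeasure volume (fun k => (T (v k) : Rn n → ℂ)) atTop g := by
  have hp0 : 0 < p.toReal := ENNReal.toReal_pos (zero_lt_one.trans_le hp1).ne' hp
  obtain ⟨C, hC, hCT⟩ := hT.exists_volume_norm_sub_le hp1 hp hf
  obtain ⟨B, hBm, -, hB2, hBlim⟩ := exists_truncation hp1 hp hf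
  obtain ⟨u, hu, hulim⟩ : ∃ u : ℕ → Lp ℂ 2 (volume : Measure (Rn n)),
      (∀ k, MemLp (u k : Rn n → ℂ) p volume) ∧
      Tendsto (fun k => eLpNorm ((u k : Rn n → ℂ) - f) p volume) atTop (𝓝 0) := by
    refine ⟨fun k => (hB2 k).toLp, fun k => (hf.indicator (hBm k)).ae_eq (hB2 k).coeFn_toLp.symm,
      hBlim.congr fun k => eLpNorm_congr_ae ?_⟩
    exact (hB2 k).coeFn_toLp.symm.sub EventuallyEq.rfl
  have hpow : ∀ (c : ℝ≥0∞), c ≠ ∞ → ∀ {ι : Type} {l : Filter ι} {e : ι → ℝ≥0∞} {a : ℝ≥0∞},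
      Tendsto e l (𝓝 a) → Tendsto (fun i => c * e i ^ p.toReal) l (𝓝 (c * a ^ p.toReal)) :=
    fun c hc _ _ _ _ he => ENNReal.Tendsto.const_mul
      ((ENNReal.continuous_rpow_const.tendsto _).comp he) (Or.inr hc)
  -- a subsequence that converges almost everywhere
  have hsub : ∀ j : ℕ, ∀ᶠ k in atTop, ∀ l ≥ k,
      volume {x | (1 / 2 : ℝ) ^ j < ‖T (u k) x - T (u l) x‖} ≤ (1 / 2 : ℝ≥0∞) ^ j := by
    intro j
    have h1 : Tendsto (fun q : ℕ × ℕ => eLpNorm ((u q.1 : Rn n → ℂ) - f) p volume +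
        eLpNorm ((u q.2 : Rn n → ℂ) - f) p volume) (atTop ×ˢ atTop) (𝓝 (0 + 0)) :=
      (hulim.comp tendsto_fst).add (hulim.comp tendsto_snd)
    have h2 := hpow _ (hC ((1 / 2 : ℝ) ^ j)) h1
    rw [add_zero, ENNReal.zero_rpow_of_pos hp0, mul_zero, prod_atTop_atTop_eq] at h2
    have h3 := h2.eventually_le_const (u := (1 / 2 : ℝ≥0∞) ^ j)
      (ENNReal.pow_pos (by norm_num) j)
    obtain ⟨N, hN⟩ := eventually_atTop.1 h3
    filter_upwards [eventually_ge_atTop (max N.1 N.2)] with k hk l hl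
    refine (hCT _ (by positivity) _ _ (hu k) (hu l)).trans (hN (k, l) ⟨?_, ?_⟩)
    · exact (le_max_left _ _).trans hk
    · exact (le_max_right _ _).trans (hk.trans hl)
  obtain ⟨φ, hφ, hφsub⟩ := extraction_forall_of_eventually hsub
  have hcauchy : ∀ᵐ x, ∃ z, Tendsto (fun j => T (u (φ j)) x) atTop (𝓝 z) := by
    have hsum : ∑' j, volume {x | (1 / 2 : ℝ) ^ j <
        ‖T (u (φ j)) x - T (u (φ (j + 1))) x‖} ≠ ∞ := by
      refine ((ENNReal.tsum_le_tsum fun j =>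
        hφsub j _ (hφ.monotone (Nat.le_succ j))).trans_lt ?_).ne
      rw [ENNReal.tsum_geometric]
      exact ENNReal.inv_lt_top.2 (by norm_num)
    filter_upwards [ae_eventually_notMem hsum] with x hx
    obtain ⟨N, hN⟩ := eventually_atTop.1 hx
    refine cauchySeq_tendsto_of_complete ?_
    rw [← cauchySeq_shift N]
    refine cauchySeq_of_le_geometric (1 / 2 : ℝ) ((1 / 2 : ℝ) ^ N) (by norm_num) fun j => ?_
    have h1 : ¬ (1 / 2 : ℝ) ^ (j + N) < ‖T (u (φ (j + N))) x - T (u (φ (j + N + 1))) x‖ :=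
      hN (j + N) (Nat.le_add_left _ _)
    rw [dist_eq_norm, ← pow_add, add_comm N j, add_right_comm j 1 N]
    exact not_lt.1 h1
  obtain ⟨g, hg, hgT⟩ := exists_stronglyMeasurable_limit_of_tendsto_ae
    (fun j => Lp.aestronglyMeasurable (T (u (φ j)))) hcauchy
  refine ⟨g, hg, fun v hv hvlim => ?_⟩
  rw [tendstoInMeasure_iff_norm]
  intro ε hε
  -- Let `j → ∞` in the estimate for `T (v k) - T (u (φ j))`. Where the limit is at least `ε`, the
  -- differences eventually exceed `ε / 2`, and the error of `u (φ j)` disappears.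
  have hbound : ∀ k, volume {x | ε ≤ ‖T (v k) x - g x‖} ≤
      C (ε / 2) * eLpNorm ((v k : Rn n → ℂ) - f) p volume ^ p.toReal := by
    intro k
    refine measure_le_of_ae_eventually_mem
      (s := fun j => {x | ε / 2 < ‖T (v k) x - T (u (φ j)) x‖}) ?_
      (fun j => hCT _ (half_pos hε) _ _ (hv k) (hu (φ j))) ?_
    · filter_upwards [hgT] with x hx hxε
      have hxε : ε ≤ ‖T (v k) x - g x‖ := hxε
      exact (tendsto_const_nhds.sub hx).norm.eventually_const_lt (by linarith)
    · refine hpow _ (hC _) ?_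
      have := (tendsto_const_nhds (x := eLpNorm ((v k : Rn n → ℂ) - f) p volume)).add
        (hulim.comp hφ.tendsto_atTop)
      rwa [add_zero] at this
  have hlim := hpow _ (hC (ε / 2)) hvlim
  rw [ENNReal.zero_rpow_of_pos hp0, mul_zero] at hlim
  exact tendsto_of_tendsto_of_tendsto_of_le_of_le tendsto_const_nhds hlim (fun _ => zero_le) hbound

end Extension

theorem theorem4 {n : ℕ} (hn : 1 ≤ n) (Γ : StandardHyperCurve n) (K : Rn n → Rn n → ℂ)
    (T : CZO Γ K) (p : ℝ≥0∞) (hp1 : 1 ≤ p) (hp : p ≠ ∞) (f : Rn n → ℂ)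
    (hf : MemLp f p volume) :
    ∃ g : Rn n → ℂ, AEStronglyMeasurable g volume ∧ T.IsValue p f g ∧
      (∀ g' : Rn n → ℂ, T.IsValue p f g' → g' =ᵐ[volume] g) ∧
      ∀ᵐ x, x ∉ Γ.preimage (essSupport f) →
        Integrable (fun y => K x y * f y) volume ∧ g x = ∫ y, K x y * f y := by
  obtain ⟨V, A, δ, h⟩ := StandardHyperCurve.IsKernel.exists_singularKernel T.isKernel
  have hrep := T.represents hn h
  have hweak : HasWeakType T.onL2 p.toReal := hrep.hasWeakType hn h
    (by rw [← ENNReal.toReal_one]; exact ENNReal.toReal_mono hp hp1)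
  obtain ⟨g, hg, hgT⟩ := hweak.exists_limit hp1 hp hf
  obtain ⟨B, hBm, hBev, hB2, hBlim⟩ := exists_truncation hp1 hp hf
  have hBp : ∀ k, MemLp ((B k).indicator f) p volume := fun k => hf.indicator (hBm k)
  have hcoe : ∀ k, (hB2 k).toLp =ᵐ[volume] (B k).indicator f := fun k => (hB2 k).coeFn_toLp
  have hup : ∀ k, MemLp ((hB2 k).toLp : Rn n → ℂ) p volume := fun k =>
    (hBp k).ae_eq (hcoe k).symm
  have hulim : Tendsto (fun k => eLpNorm (((hB2 k).toLp : Rn n → ℂ) - f) p volume) atTop (𝓝 0) :=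
    hBlim.congr fun k => eLpNorm_congr_ae ((hcoe k).symm.sub EventuallyEq.rfl)
  have hmeas := hgT _ hup hulim
  -- The truncations of `f` form one admissible sequence, and limits in measure are unique almost
  -- everywhere.
  refine ⟨g, hg.aestronglyMeasurable, hgT, fun g' hg' =>
    tendstoInMeasure_ae_unique (hg' _ hup hulim) hmeas, ?_⟩
  obtain ⟨ns, hns, hnsT⟩ := hmeas.exists_seq_tendsto_ae
  have hf0 := ae_eq_zero_of_notMem_essSupport f
  have hB0 : ∀ k, ∀ᵐ y, y ∉ essSupport f → (B k).indicator f y = 0 := fun k => by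
    filter_upwards [hf0] with y hy hyS
    exact indicator_apply_eq_zero.2 fun _ => hy hyS
  -- The lower bound for `ρ(x, ·)` depends on `x`, whereas `Represents` gives a null set for each
  -- fixed separation. Restricting to the separations `1 / (m + 1)` leaves countably many null sets.
  have hrepB : ∀ᵐ x, ∀ k m : ℕ, (∀ y ∈ essSupport f, 1 / ((m : ℝ) + 1) ≤ Γ.rho x y) →
      T.onL2 (hB2 k).toLp x = ∫ y, K x y * (B k).indicator f y := by
    refine ae_all_iff.2 fun k => ae_all_iff.2 fun m => ?_
    have h0 : ∀ᵐ y, y ∉ essSupport f → (hB2 k).toLp _ y = 0 := by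
      filter_upwards [hcoe k, hB0 k] with y h1 h2 hyS
      rw [h1, h2 hyS]
    filter_upwards [hrep (hB2 k).toLp (essSupport f)
      {x | ∀ y ∈ essSupport f, 1 / ((m : ℝ) + 1) ≤ Γ.rho x y} (1 / ((m : ℝ) + 1)) (by positivity)
      h0 fun x hx => hx] with x hx hxm
    rw [hx hxm]
    refine integral_congr_ae ?_
    filter_upwards [hcoe k] with y hy
    rw [hy]
  filter_upwards [hnsT, hrepB] with x hxT hxB hxS
  obtain ⟨ε, hε, hερ⟩ := Γ.exists_pos_le_rho (S := essSupport f) Measure.isClosed_support hxS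
  have hint := h.integrable_kernel_mul hn hε hp1 hp hf hf0 hερ
  refine ⟨hint, ?_⟩
  obtain ⟨m, hm⟩ := exists_nat_one_div_lt hε
  -- The truncations are dominated by `f` and eventually equal to it at each point, so the
  -- integrable function `|K(x, ·) f|` is a majorant.
  have hlim : Tendsto (fun k => ∫ y, K x y * (B k).indicator f y) atTop
      (𝓝 (∫ y, K x y * f y)) := by
    refine tendsto_integral_of_dominated_convergence (fun y => ‖K x y * f y‖)
      (fun k => (h.integrable_kernel_mul hn hε hp1 hp (hBp k) (hB0 k)
        hερ).aestronglyMeasurable) hint.norm (fun k => ae_of_all _ fun y => ?_)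
      (ae_of_all _ fun y => ?_)
    · rw [norm_mul, norm_mul]
      gcongr
      exact norm_indicator_le_norm_self f y
    · refine tendsto_const_nhds.congr' ?_
      filter_upwards [hBev y] with k hk
      rw [indicator_of_mem hk]
  have hlim2 := hlim.comp hns.tendsto_atTop
  refine tendsto_nhds_unique hxT (hlim2.congr fun j => ?_)
  exact (hxB (ns j) m fun y hy => hm.le.trans (hερ y hy)).symm
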